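/- For each integer $n\ge 1$ let $\mu_n$ be a rotation-invariant probability measure on $\mathbb C$ such that polynomials of degree less than $n$ belong to $L^2(\mathbb C,\mu_n)$, and let $K_n$ be the integral kernel of the orthogonal projection of $L^2(\mathbb C,\mu_n)$ onto the subspace of polynomials of degree less than $n$ (in the version that is a polynomial in $z$ and $\bar w$). Let the random points $z_1,\dots,z_n$ form the symmetric polynomial projection process defined by $(\mu_n,n)$; that is, the process has $n$ points, and their $n$-point joint intensity with respect to $\mu_n^{\otimes n}$ is $\det\bigl(K_n(x_i,x_j)\bigr)_{1\le i,j\le n}$: for every measurable $\varphi:\mathbb C^n\to[0,\infty]$, $$\mathbf E\sum_{\sigma\in S_n}\varphi(z_{\sigma(1)},\dots,z_{\sigma(n)})=\int_{\mathbb C^n}\varphi(x_1,\dots,x_n)\,\det\bigl(K_n(x_i,x_j)\bigr)_{i,j}\,d\mu_n(x_1)\cdots d\mu_n(x_n).$$ Put $M(n,k)=\int_{\mathbb C}|z|^k\,d\mu_n(z)$ and assume that for every integer $m$ (positive, zero or negative) $$\frac{M(n,2n+2m)}{M(n,2n)}\longrightarrow 1\qquad (n\to\infty).$$ Then for every polynomial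 $f$ in $z$ with complex coefficients, the variables $f(z_k)$, $1\le k\le n$, are integrable for all sufficiently large $n$, and, as $n\to\infty$, $$\sum_{k=1}^n\bigl(f(z_k)-\mathbf E f(z_k)\bigr)\;\Rightarrow\;\mathcal N_{\mathbb C}\Bigl(0,\ \tfrac1\pi\|f'\|_{L^2(\mathbb U)}^2\Bigr)\quad\text{in distribution},$$ where $\|f'\|_{L^2(\mathbb U)}^2=\int_{|w|<1}|f'(w)|^2\,d^2w$ ($d^2w$ is Lebesgue measure on the unit disk $\mathbb U$) and $\mathcal N_{\mathbb C}(0,v)$ is the law of a complex random variable whose real and imaginary parts are independent centered real Gaussians of variance $v/2$ each (so $\mathbf E|Z|^2=v$). -/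

import Mathlib

open MeasureTheory ProbabilityTheory Filter Polynomial
open scoped Topology NNReal ENNReal ComplexConjugate

noncomputable section

/-- A measure on `ℂ` is rotation invariant if it is preserved by `z ↦ c z` for every `|c| = 1`. -/
def IsRotationInvariant (μ : Measure ℂ) : Prop :=
  ∀ c : ℂ, ‖c‖ = 1 → μ.map (fun z => c * z) = μ

/-- The absolute moment `∫ |z| ^ k dμ(z)`, for an integer exponent `k`. -/
def absMoment (μ : Measure ℂ) (k : ℤ) : ℝ :=
  ∫ z, ‖z‖ ^ k ∂μ

/-- `K` is the integral kernel of the orthogonal projection of `L²(ℂ, μ)` onto the subspace of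
polynomials of degree less than `n`.  An integral kernel is determined only almost everywhere; as
usual the version is meant that is a polynomial in `z` (and in the conjugate of `w`), so that the
values on the diagonal make sense. -/
structure IsPolynomialProjectionKernel (μ : Measure ℂ) (n : ℕ) (K : ℂ → ℂ → ℂ) : Prop where
  /-- Polynomials of degree less than `n` belong to `L²(ℂ, μ)`. -/
  memLp : ∀ p ∈ degreeLT ℂ n, MemLp (fun z => p.eval z) 2 μ
  /-- `K(·, w)` is a polynomial of degree less than `n`. -/
  polynomial : ∀ w, ∃ p ∈ degreeLT ℂ n, ∀ z, K z w = p.eval z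
  /-- `K` is Hermitian. -/
  hermitian : ∀ z w, K w z = conj (K z w)
  /-- For `g ∈ L²(ℂ, μ)`, the function `z ↦ ∫ K(z, w) g(w) dμ(w)` is the orthogonal projection
  `p` of `g`: a polynomial of degree less than `n` with `g - p` orthogonal to all of these. -/
  projection : ∀ g : ℂ → ℂ, MemLp g 2 μ → ∃ p ∈ degreeLT ℂ n,
    (∀ᵐ z ∂μ, ∫ w, K z w * g w ∂μ = p.eval z) ∧
    ∀ q ∈ degreeLT ℂ n, ∫ z, (g z - p.eval z) * conj (q.eval z) ∂μ = 0

/-- The random points `z₁, …, zₙ` (in an arbitrary labelling) have `k`-point joint intensity `ρ`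
with respect to `μ ^ k`: for every measurable `φ ≥ 0` on `ℂ ^ k`, the expectation of the sum of
`φ (z_{i₁}, …, z_{iₖ})` over all `k`-tuples of distinct indices is `∫ φ ρ dμ ^ k`. -/
def HasJointIntensity {Ω : Type*} [MeasurableSpace Ω] (P : Measure Ω) {n : ℕ}
    (z : Ω → Fin n → ℂ) (μ : Measure ℂ) (k : ℕ) (ρ : (Fin k → ℂ) → ℝ) : Prop :=
  ∀ φ : (Fin k → ℂ) → ℝ≥0∞, Measurable φ →
    ∫⁻ ω, ∑ e : Fin k ↪ Fin n, φ (fun i => z ω (e i)) ∂P =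
      ∫⁻ x, φ x * ENNReal.ofReal (ρ x) ∂(Measure.pi fun _ : Fin k => μ)

/-- The random points `z₁, …, zₙ`, defined on the probability space `(Ω, P)`, form the symmetric
polynomial projection process defined by `(μ, n)`: `μ` is a rotation invariant probability measure
on `ℂ`, and the `n`-point joint intensity with respect to `μ ^ n` is `det (K(xᵢ, xⱼ))` (a
nonnegative real number), with `K` the projection kernel onto the polynomials of degree less
than `n` in `L²(ℂ, μ)`. -/
structure IsSPPProcess {Ω : Type*} [MeasurableSpace Ω] (P : Measure Ω) (μ : Measure ℂ) (n : ℕ)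
    (z : Ω → Fin n → ℂ) : Prop where
  isProbabilityMeasure : IsProbabilityMeasure μ
  rotationInvariant : IsRotationInvariant μ
  aemeasurable : AEMeasurable z P
  jointIntensity : ∃ K : ℂ → ℂ → ℂ, IsPolynomialProjectionKernel μ n K ∧
    HasJointIntensity P z μ n
      (fun x => (Matrix.det (Matrix.of fun i j : Fin n => K (x i) (x j))).re)

/-- The (circularly symmetric) complex Gaussian law with mean `m` and variance
`E |Z - m|² = v`: the real and imaginary parts are independent real Gaussians with
variance `v / 2` each. -/
def complexGaussian (m : ℂ) (v : ℝ≥0) : Measure ℂ :=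
  ((gaussianReal m.re (v / 2)).prod (gaussianReal m.im (v / 2))).map
    Complex.measurableEquivRealProd.symm

instance complexGaussian_isProbabilityMeasure (m : ℂ) (v : ℝ≥0) :
    IsProbabilityMeasure (complexGaussian m v) :=
  Measure.isProbabilityMeasure_map Complex.measurableEquivRealProd.symm.measurable.aemeasurable

end

noncomputable section

/-! Write `h j` for the moment of `|z| ^ (2 * j)`, `W` for the product of `h j` over `j < n`, `Δ`
for the Vandermonde determinant and `S` for the sum of `g` over the points, where `g` is `f` without
its constant term. Rotation invariance makes monomials orthogonal, so the kernel is explicit and the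
joint density is `|Δ| ^ 2 / W` (`IsPolynomialProjectionKernel.det_eq`). Hence `E[S ^ p * conj S ^
q]` equals `1 / (n! * W)` times the inner product of `S ^ p * Δ` and `S ^ q * Δ` in `L²(μ ^ n)`.
This is a weighted pairing of coefficients, an exponent `m` having weight `∏ h (m i)`.

Both polynomials are alternating, of degree at most a constant `d` above that of `Δ`. The values of
an exponent of such a polynomial form an `n`-element set that differs from `{0, …, n - 1}` in at
most `d` places, all within distance `d` of `n`. There the moments have ratios close to one, so
every weight is close to `W` (`abs_momentWeight_sub_le`), and asymptotically all weights may be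
replaced by the constant `W`.

With unit weights the moments are exactly Gaussian once `n` is large, by an oscillator argument. The
adjoint of multiplication by `S` is `lowering g`; it kills the vacuum `Δ`, and its commutator with
`S` is the scalar `energy g = ∑ k * |a k| ^ 2` on states whose low levels are all filled
(`lowering_linStat_mul`). Moving adjoints across gives `p! * energy g ^ p` on the diagonal and zero
off it (`pairing_excited`).

So all mixed moments of `S` converge to those of a complex Gaussian
(`tendsto_integral_linStat_pow`). Taylor expansion of the characteristic function turns this into
convergence in law (`tendsto_integral_exp_of_moments`), and the energy is the Dirichlet integral of
`f` over the disk divided by `π` (`integral_ball_norm_sq_derivative`). -/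

namespace AlternatingPolynomial

/-! ### Coefficients of alternating polynomials -/

variable {n : ℕ}

/-- The coefficient of a polynomial in `n` variables, indexed by exponent functions. -/
def coeffFn (P : MvPolynomial (Fin n) ℂ) (m : Fin n → ℕ) : ℂ :=
  P.coeff (Finsupp.equivFunOnFinite.symm m)

lemma coeffFn_coe (P : MvPolynomial (Fin n) ℂ) (m : Fin n →₀ ℕ) :
    coeffFn P m = P.coeff m := by
  simp [coeffFn]

lemma coeffFn_add (P Q : MvPolynomial (Fin n) ℂ) (m : Fin n → ℕ) :
    coeffFn (P + Q) m = coeffFn P m + coeffFn Q m := by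
  simp [coeffFn]

lemma coeffFn_smul (c : ℂ) (P : MvPolynomial (Fin n) ℂ) (m : Fin n → ℕ) :
    coeffFn (c • P) m = c * coeffFn P m := by
  simp [coeffFn]

lemma coeffFn_sum {ι : Type*} (s : Finset ι) (P : ι → MvPolynomial (Fin n) ℂ) (m : Fin n → ℕ) :
    coeffFn (∑ i ∈ s, P i) m = ∑ i ∈ s, coeffFn (P i) m := by
  simp [coeffFn, MvPolynomial.coeff_sum]

lemma ext_coeffFn {P Q : MvPolynomial (Fin n) ℂ} (h : ∀ m, coeffFn P m = coeffFn Q m) : P = Q := by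
  ext m
  simpa [coeffFn_coe] using h m

lemma coeffFn_X_pow_mul (i : Fin n) (l : ℕ) (P : MvPolynomial (Fin n) ℂ) (m : Fin n → ℕ) :
    coeffFn (MvPolynomial.X i ^ l * P) m =
      if l ≤ m i then coeffFn P (Function.update m i (m i - l)) else 0 := by
  rw [coeffFn, MvPolynomial.X_pow_eq_monomial, MvPolynomial.coeff_monomial_mul', one_mul]
  simp only [Finsupp.single_le_iff, Finsupp.equivFunOnFinite_symm_apply_apply]
  refine if_congr Iff.rfl ?_ rfl
  unfold coeffFn
  congr 1
  ext j
  rcases eq_or_ne j i with rfl | hj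
  · simp
  · simp [hj, Finsupp.single_eq_of_ne hj]

lemma coeffFn_divMonomial (i : Fin n) (k : ℕ) (P : MvPolynomial (Fin n) ℂ) (m : Fin n → ℕ) :
    coeffFn (P.divMonomial (Finsupp.single i k)) m =
      coeffFn P (Function.update m i (m i + k)) := by
  rw [coeffFn, MvPolynomial.coeff_divMonomial, coeffFn]
  congr 1
  ext j
  rcases eq_or_ne j i with rfl | hj
  · simp [add_comm]
  · simp [hj, Finsupp.single_eq_of_ne hj]

/-- A polynomial is alternating if each transposition of the variables changes its sign. -/
def IsAlternating (P : MvPolynomial (Fin n) ℂ) : Prop :=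
  ∀ i j, i ≠ j → MvPolynomial.rename (Equiv.swap i j) P = -P

lemma IsAlternating.coeffFn_comp_swap {P : MvPolynomial (Fin n) ℂ} (hP : IsAlternating P)
    {i j : Fin n} (hij : i ≠ j) (m : Fin n → ℕ) :
    coeffFn P (m ∘ Equiv.swap i j) = -coeffFn P m := by
  have h := MvPolynomial.coeff_rename_mapDomain (Equiv.swap i j) (Equiv.swap i j).injective P
    (Finsupp.equivFunOnFinite.symm (m ∘ Equiv.swap i j))
  rw [hP i j hij, MvPolynomial.coeff_neg] at h
  rw [coeffFn, coeffFn, ← h]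
  congr 2
  ext a
  rw [← Finsupp.equivMapDomain_eq_mapDomain]
  simp

/-- A one-particle operator applied to an alternating polynomial has no coefficients at
exponents with a repetition. -/
lemma IsAlternating.sum_update_eq_zero {P : MvPolynomial (Fin n) ℂ} (hP : IsAlternating P)
    (w : ℕ → ℂ) (θ : ℕ → ℕ) {m : Fin n → ℕ} (hm : ¬ Function.Injective m) :
    ∑ i, w (m i) * coeffFn P (Function.update m i (θ (m i))) = 0 := by
  obtain ⟨a, b, hab, hne⟩ : ∃ a b, m a = m b ∧ a ≠ b := by
    simpa [Function.Injective] using hm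
  have hinv : ∀ i, m (Equiv.swap a b i) = m i := by
    intro i
    rcases eq_or_ne i a with rfl | hia
    · simp [hab]
    rcases eq_or_ne i b with rfl | hib
    · simp [hab]
    rw [Equiv.swap_apply_of_ne_of_ne hia hib]
  -- Swapping two positions at which `m` agrees permutes the summands and reverses their signs, so
  -- the sum equals its own negative.
  have key : ∀ i, coeffFn P (Function.update m (Equiv.swap a b i) (θ (m i))) =
      -coeffFn P (Function.update m i (θ (m i))) := by
    intro i
    rw [← hP.coeffFn_comp_swap hne]
    congr 1
    ext j
    rcases eq_or_ne j (Equiv.swap a b i) with rfl | hj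
    · simp
    · have : Equiv.swap a b j ≠ i := fun h => hj (by rw [← h]; simp)
      simp [hj, this, hinv]
  have h2 : ∑ i, w (m i) * coeffFn P (Function.update m i (θ (m i))) =
      -∑ i, w (m i) * coeffFn P (Function.update m i (θ (m i))) := by
    conv_lhs => rw [← Equiv.sum_comp (Equiv.swap a b)]
    rw [← Finset.sum_neg_distrib]
    refine Finset.sum_congr rfl fun i _ => ?_
    rw [hinv, key]
    ring
  exact self_eq_neg.mp h2

lemma IsAlternating.coeffFn_eq_zero {P : MvPolynomial (Fin n) ℂ} (hP : IsAlternating P)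
    {m : Fin n → ℕ} (hm : ¬ Function.Injective m) : coeffFn P m = 0 := by
  obtain ⟨a, b, hab, hne⟩ : ∃ a b, m a = m b ∧ a ≠ b := by
    simpa [Function.Injective] using hm
  have h := hP.coeffFn_comp_swap hne m
  have : m ∘ Equiv.swap a b = m := by
    ext i
    rcases eq_or_ne i a with rfl | hia
    · simp [hab]
    rcases eq_or_ne i b with rfl | hib
    · simp [hab]
    simp [Equiv.swap_apply_of_ne_of_ne hia hib]
  rw [this] at h
  exact self_eq_neg.mp h

/-! ### Linear statistics, their adjoints and the commutator -/

/-- The linear statistic `∑ᵢ g(Xᵢ)`. -/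
def linStat (n : ℕ) (g : ℂ[X]) : MvPolynomial (Fin n) ℂ :=
  ∑ i, Polynomial.aeval (MvPolynomial.X i) g

lemma linStat_eq (g : ℂ[X]) : linStat n g =
    ∑ i, ∑ k ∈ Finset.range (g.natDegree + 1), g.coeff k • MvPolynomial.X i ^ k := by
  simp only [linStat, Polynomial.aeval_eq_sum_range]

/-- The formal adjoint of the multiplication by `∑ᵢ g(Xᵢ)`. -/
def lowering (g : ℂ[X]) (P : MvPolynomial (Fin n) ℂ) : MvPolynomial (Fin n) ℂ :=
  ∑ i, ∑ k ∈ Finset.range (g.natDegree + 1),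
    conj (g.coeff k) • P.divMonomial (Finsupp.single i k)

lemma IsAlternating.linStat_mul {P : MvPolynomial (Fin n) ℂ} (hP : IsAlternating P) (g : ℂ[X]) :
    IsAlternating (linStat n g * P) := by
  intro i j hij
  rw [map_mul, hP i j hij, mul_neg]
  congr 2
  rw [linStat_eq, map_sum]
  simp only [map_sum, map_smul, map_pow, MvPolynomial.rename_X]
  exact Equiv.sum_comp (Equiv.swap i j)
    (fun a => ∑ k ∈ Finset.range (g.natDegree + 1), g.coeff k • MvPolynomial.X a ^ k)

/-- The energy `∑ k |aₖ|²` of a polynomial `∑ aₖ Xᵏ`. -/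
def energy (g : ℂ[X]) : ℝ := ∑ k ∈ Finset.range (g.natDegree + 1), k * ‖g.coeff k‖ ^ 2

/-- All exponents occurring in `P` fill the levels `0, …, D - 1`. -/
def FillsLevels (D : ℕ) (P : MvPolynomial (Fin n) ℂ) : Prop :=
  ∀ m, coeffFn P m ≠ 0 → ∀ s < D, ∃ i, m i = s

lemma coeffFn_linStat_mul (g : ℂ[X]) (P : MvPolynomial (Fin n) ℂ) (m : Fin n → ℕ) :
    coeffFn (linStat n g * P) m = ∑ i, ∑ l ∈ Finset.range (g.natDegree + 1), g.coeff l *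
      if l ≤ m i then coeffFn P (Function.update m i (m i - l)) else 0 := by
  simp only [linStat_eq, Finset.sum_mul, coeffFn_sum, smul_mul_assoc, coeffFn_smul,
    coeffFn_X_pow_mul]

lemma coeffFn_lowering (g : ℂ[X]) (P : MvPolynomial (Fin n) ℂ) (m : Fin n → ℕ) :
    coeffFn (lowering g P) m = ∑ i, ∑ k ∈ Finset.range (g.natDegree + 1), conj (g.coeff k) *
      coeffFn P (Function.update m i (m i + k)) := by
  simp only [lowering, coeffFn_sum, coeffFn_smul, coeffFn_divMonomial]

/-- Operators in different variables commute. In one variable, multiplying by `X ^ l` before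
dividing by `X ^ k` needs only `l ≤ m i + k`, while the other order needs `l ≤ m i`; the correction
lives on the exponents in between. -/
lemma coeffFn_commutator_single (P : MvPolynomial (Fin n) ℂ) (m : Fin n → ℕ) (i j : Fin n)
    (k l : ℕ) :
    coeffFn ((MvPolynomial.X j ^ l * P).divMonomial (Finsupp.single i k)) m =
      coeffFn (MvPolynomial.X j ^ l * P.divMonomial (Finsupp.single i k)) m +
      if i = j then (if m i < l ∧ l ≤ m i + k then (1 : ℂ) else 0) *
        coeffFn P (Function.update m i (m i + k - l)) else 0 := by
  rw [coeffFn_divMonomial, coeffFn_X_pow_mul, coeffFn_X_pow_mul, coeffFn_divMonomial]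
  rcases eq_or_ne i j with rfl | hij
  · simp only [Function.update_self, Function.update_idem, if_true]
    by_cases h1 : l ≤ m i
    · have h2 : l ≤ m i + k := by omega
      have h3 : m i - l + k = m i + k - l := by omega
      simp [h1, h2, h3]
    · by_cases h2 : l ≤ m i + k
      · simp [h1, h2, not_le.mp h1]
      · simp [h1, h2]
  · simp only [hij, if_false, add_zero, Function.update_of_ne hij.symm, Function.update_of_ne hij]
    rw [Function.update_comm hij]

/-- For injective `m` and `k = l` the sum counts the `i` with `m i < k`, and filled levels make this
count `k`. For `k ≠ l`, a nonzero term would move a particle away from the low level `m i`, which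
must still be filled, hence by another particle, against injectivity. For non-injective `m` both
sides vanish by antisymmetry. -/
lemma commutator_term {P : MvPolynomial (Fin n) ℂ} (hP : IsAlternating P) {D : ℕ}
    (hD : FillsLevels D P) {k l : ℕ} (hl : l ≤ D) (m : Fin n → ℕ) :
    ∑ i, (if m i < l ∧ l ≤ m i + k then (1 : ℂ) else 0) *
        coeffFn P (Function.update m i (m i + k - l)) =
      if k = l then (k : ℂ) * coeffFn P m else 0 := by
  by_cases hm : Function.Injective m
  · split_ifs with hkl
    · subst hkl
      have : ∀ i, (if m i < k ∧ k ≤ m i + k then (1 : ℂ) else 0) *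
          coeffFn P (Function.update m i (m i + k - k)) =
          (if m i < k then (1 : ℂ) else 0) * coeffFn P m := by
        intro i
        simp
      simp only [this, ← Finset.sum_mul]
      by_cases h0 : coeffFn P m = 0
      · simp [h0]
      congr 1
      rw [Finset.sum_boole]
      congr 1
      rw [← Finset.card_range k]
      refine Finset.card_bij (fun i _ => m i) ?_ ?_ ?_
      · intro i hi
        simpa using hi
      · intro i _ j _ hij
        exact hm hij
      · intro s hs
        have hs' : s < k := by simpa using hs
        obtain ⟨i, hi⟩ := hD m h0 s (by omega)
        exact ⟨i, by simpa [hi] using hs', hi⟩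
    · refine Finset.sum_eq_zero fun i _ => ?_
      split_ifs with h
      · by_contra hne
        rw [one_mul] at hne
        obtain ⟨j, hj⟩ := hD _ hne (m i) (by omega)
        rcases eq_or_ne j i with rfl | hji
        · rw [Function.update_self] at hj
          omega
        · rw [Function.update_of_ne hji] at hj
          exact hji (hm hj)
      · simp
  · rw [hP.coeffFn_eq_zero hm]
    simpa using hP.sum_update_eq_zero (fun a => if a < l ∧ l ≤ a + k then (1 : ℂ) else 0)
      (fun a => a + k - l) hm

/-- The Heisenberg commutation relation: filled low levels turn the commutator into a scalar, the
off-diagonal terms `k ≠ l` cancelling after summation over the variables. -/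
lemma lowering_linStat_mul {P : MvPolynomial (Fin n) ℂ} (hP : IsAlternating P) {g : ℂ[X]}
    (hD : FillsLevels g.natDegree P) :
    lowering g (linStat n g * P) = linStat n g * lowering g P + (energy g : ℂ) • P := by
  set R := Finset.range (g.natDegree + 1) with hR
  have e1 : lowering g (linStat n g * P) = ∑ i, ∑ k ∈ R, ∑ j, ∑ l ∈ R,
      (conj (g.coeff k) * g.coeff l) •
        (MvPolynomial.X j ^ l * P).divMonomial (Finsupp.single i k) := by
    refine ext_coeffFn fun m => ?_
    simp only [coeffFn_lowering, coeffFn_linStat_mul, coeffFn_sum, coeffFn_smul,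
      coeffFn_divMonomial, coeffFn_X_pow_mul, Finset.mul_sum, mul_assoc, hR]
  have e2 : linStat n g * lowering g P = ∑ i, ∑ k ∈ R, ∑ j, ∑ l ∈ R,
      (conj (g.coeff k) * g.coeff l) •
        (MvPolynomial.X j ^ l * P.divMonomial (Finsupp.single i k)) := by
    rw [lowering, Finset.mul_sum]
    refine Finset.sum_congr rfl fun i _ => ?_
    rw [Finset.mul_sum]
    refine Finset.sum_congr rfl fun k _ => ?_
    rw [linStat_eq, Finset.sum_mul]
    refine Finset.sum_congr rfl fun j _ => ?_
    rw [Finset.sum_mul]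
    refine Finset.sum_congr rfl fun l _ => ?_
    rw [smul_mul_smul_comm, mul_comm (g.coeff l)]
  rw [e1, e2]
  refine ext_coeffFn fun m => ?_
  simp only [coeffFn_add, coeffFn_sum, coeffFn_smul, coeffFn_commutator_single, mul_add,
    Finset.sum_add_distrib]
  congr 1
  calc _ = ∑ i, ∑ k ∈ R, ∑ l ∈ R, conj (g.coeff k) * g.coeff l *
        ((if m i < l ∧ l ≤ m i + k then (1 : ℂ) else 0) *
        coeffFn P (Function.update m i (m i + k - l))) := by
        refine Finset.sum_congr rfl fun i _ => Finset.sum_congr rfl fun k _ => ?_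
        rw [Finset.sum_comm]
        refine Finset.sum_congr rfl fun l _ => ?_
        rw [← Finset.mul_sum]
        simp
    _ = ∑ k ∈ R, ∑ l ∈ R, conj (g.coeff k) * g.coeff l *
        ∑ i, ((if m i < l ∧ l ≤ m i + k then (1 : ℂ) else 0) *
        coeffFn P (Function.update m i (m i + k - l))) := by
        rw [Finset.sum_comm]
        refine Finset.sum_congr rfl fun k _ => ?_
        rw [Finset.sum_comm]
        simp only [Finset.mul_sum]
    _ = ∑ k ∈ R, ∑ l ∈ R, conj (g.coeff k) * g.coeff l *
        (if k = l then (k : ℂ) * coeffFn P m else 0) := by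
        refine Finset.sum_congr rfl fun k _ => Finset.sum_congr rfl fun l hl => ?_
        rw [commutator_term hP hD]
        simp [hR] at hl
        omega
    _ = _ := by
        rw [energy, Complex.ofReal_sum, Finset.sum_mul]
        refine Finset.sum_congr rfl fun k (hk : k ∈ R) => ?_
        simp only [mul_ite, mul_zero, Finset.sum_ite_eq, hk, if_true]
        push_cast
        rw [Complex.conj_mul']
        ring

/-! ### Sets of `n` levels whose sum is almost minimal -/

section LevelSets

lemma card_sdiff_range {A : Finset ℕ} (hA : A.card = n) :
    (A \ Finset.range n).card = (Finset.range n \ A).card := by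
  have h1 := Finset.card_sdiff_add_card_inter A (Finset.range n)
  have h2 := Finset.card_sdiff_add_card_inter (Finset.range n) A
  rw [Finset.inter_comm] at h2
  rw [Finset.card_range] at h2
  omega

/-- Elements of `A` outside `range n` are particles, missing elements of `range n` are holes, and
there are equally many of both. Measuring particles from `n - 1` makes each cost at least 1 and each
hole at least 0, so a bound on the total excess controls both their number and their distance from
`n`. -/
lemma sum_excess {A : Finset ℕ} (hA : A.card = n) :
    ((∑ a ∈ A, a : ℕ) : ℤ) - ((∑ s ∈ Finset.range n, s : ℕ) : ℤ) =
      ∑ a ∈ A \ Finset.range n, ((a : ℤ) + 1 - n) +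
        ∑ s ∈ Finset.range n \ A, ((n : ℤ) - 1 - s) := by
  have h1 := Finset.sum_inter_add_sum_sdiff A (Finset.range n) (fun a => (a : ℤ))
  have h2 := Finset.sum_inter_add_sum_sdiff (Finset.range n) A (fun a => (a : ℤ))
  rw [Finset.inter_comm] at h2
  push_cast
  rw [← h1, ← h2]
  simp only [Finset.sum_sub_distrib, Finset.sum_add_distrib, Finset.sum_const, nsmul_eq_mul,
    card_sdiff_range hA]
  ring

lemma excess_above_pos {A : Finset ℕ} {a : ℕ} (ha : a ∈ A \ Finset.range n) :
    1 ≤ (a : ℤ) + 1 - n := by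
  simp at ha
  omega

lemma excess_below_nonneg {A : Finset ℕ} {s : ℕ} (hs : s ∈ Finset.range n \ A) :
    0 ≤ (n : ℤ) - 1 - s := by
  simp at hs
  omega

lemma card_le_sum_excess (A : Finset ℕ) : ((A \ Finset.range n).card : ℤ) ≤
    ∑ a ∈ A \ Finset.range n, ((a : ℤ) + 1 - n) := by
  have := Finset.card_nsmul_le_sum (A \ Finset.range n) (fun a => (a : ℤ) + 1 - n) 1
    fun a ha => excess_above_pos ha
  simpa using this

lemma sum_range_le_sum {A : Finset ℕ} (hA : A.card = n) :
    ∑ s ∈ Finset.range n, s ≤ ∑ a ∈ A, a := by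
  have h := sum_excess hA
  have h1 := Finset.sum_nonneg fun s (hs : s ∈ Finset.range n \ A) => excess_below_nonneg hs
  have h2 := card_le_sum_excess (n := n) A
  omega

lemma card_sdiff_le {A : Finset ℕ} (hA : A.card = n) {d : ℕ}
    (hd : ∑ a ∈ A, a ≤ ∑ s ∈ Finset.range n, s + d) : (A \ Finset.range n).card ≤ d := by
  have h := sum_excess hA
  have h1 := Finset.sum_nonneg fun s (hs : s ∈ Finset.range n \ A) => excess_below_nonneg hs
  have h2 := card_le_sum_excess (n := n) A
  omega

lemma mem_of_sum_le {A : Finset ℕ} (hA : A.card = n) {d : ℕ}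
    (hd : ∑ a ∈ A, a ≤ ∑ s ∈ Finset.range n, s + d) {s : ℕ} (hs : s + d < n) : s ∈ A := by
  by_contra hsA
  have hmem : s ∈ Finset.range n \ A := by
    simp [hsA]
    omega
  have h := sum_excess hA
  have h1 := Finset.single_le_sum
    (fun s (hs : s ∈ Finset.range n \ A) => excess_below_nonneg hs) hmem
  have h2 := card_le_sum_excess (n := n) A
  have h3 : 0 < (Finset.range n \ A).card := Finset.card_pos.mpr ⟨s, hmem⟩
  rw [← card_sdiff_range hA] at h3
  omega

lemma lt_of_sum_le {A : Finset ℕ} (hA : A.card = n) {d : ℕ}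
    (hd : ∑ a ∈ A, a ≤ ∑ s ∈ Finset.range n, s + d) {a : ℕ} (ha : a ∈ A) : a < n + d := by
  by_contra han
  have hmem : a ∈ A \ Finset.range n := by
    simp [ha]
    omega
  have h := sum_excess hA
  have h1 := Finset.sum_nonneg fun s (hs : s ∈ Finset.range n \ A) => excess_below_nonneg hs
  have h2 := Finset.single_le_sum
    (fun a (ha : a ∈ A \ Finset.range n) => (zero_le_one.trans (excess_above_pos ha))) hmem
  omega

/-- Common levels cancel. At most `d` particles and as many holes remain, all near `n`; comparing
each with `c` costs a factor `b`, which gives the exponent `2 * d`. -/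
lemma prod_ratio_bound {A : Finset ℕ} (hA : A.card = n) {d : ℕ}
    (hd : ∑ a ∈ A, a ≤ ∑ s ∈ Finset.range n, s + d) {h : ℕ → ℝ} (hpos : ∀ j, j < n + d → 0 < h j)
    {c b : ℝ} (hc : 0 < c) (hb : 1 ≤ b)
    (hh : ∀ j, n ≤ j + d → j < n + d → h j ≤ b * c ∧ c ≤ b * h j) :
    ∏ a ∈ A, h a ≤ b ^ (2 * d) * ∏ s ∈ Finset.range n, h s ∧
      ∏ s ∈ Finset.range n, h s ≤ b ^ (2 * d) * ∏ a ∈ A, h a := by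
  have hb0 : 0 < b := by linarith
  set U := ∏ a ∈ A \ Finset.range n, h a with hU
  set V := ∏ s ∈ Finset.range n \ A, h s with hV
  set r := (A \ Finset.range n).card with hr
  have hrd : r ≤ d := card_sdiff_le hA hd
  have h1 := Finset.prod_inter_mul_prod_sdiff A (Finset.range n) h
  have h2 := Finset.prod_inter_mul_prod_sdiff (Finset.range n) A h
  rw [Finset.inter_comm] at h2
  set I := ∏ a ∈ A ∩ Finset.range n, h a with hI
  have hIpos : 0 < I := Finset.prod_pos fun a ha => hpos a (by simp at ha; omega)
  have ineq : ∀ B C : Finset ℕ, B.card = r → C.card = r →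
      (∀ j ∈ B, n ≤ j + d ∧ j < n + d) → (∀ j ∈ C, n ≤ j + d ∧ j < n + d) →
      ∏ j ∈ B, h j ≤ b ^ (2 * d) * ∏ j ∈ C, h j := by
    intro B C hB hC hBd hCd
    have e1 : ∏ j ∈ B, h j ≤ (b * c) ^ r := by
      rw [← hB, ← Finset.prod_const]
      exact Finset.prod_le_prod (fun j hj => (hpos j (hBd j hj).2).le)
        fun j hj => (hh j (hBd j hj).1 (hBd j hj).2).1
    have e2 : c ^ r ≤ b ^ r * ∏ j ∈ C, h j := by
      rw [← hC, ← Finset.prod_const, ← Finset.prod_const, ← Finset.prod_mul_distrib]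
      exact Finset.prod_le_prod (fun j hj => hc.le)
        fun j hj => (hh j (hCd j hj).1 (hCd j hj).2).2
    have hCpos : 0 < ∏ j ∈ C, h j := Finset.prod_pos fun j hj => hpos j (hCd j hj).2
    calc ∏ j ∈ B, h j ≤ b ^ r * c ^ r := by rw [← mul_pow]; exact e1
      _ ≤ b ^ r * (b ^ r * ∏ j ∈ C, h j) := by gcongr
      _ = b ^ (2 * r) * ∏ j ∈ C, h j := by rw [two_mul, pow_add]; ring
      _ ≤ _ := by gcongr
  have hAbd : ∀ j ∈ A \ Finset.range n, n ≤ j + d ∧ j < n + d := by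
    intro j hj
    have hj' : j ∈ A ∧ n ≤ j := by simpa using hj
    exact ⟨by omega, lt_of_sum_le hA hd hj'.1⟩
  have hRbd : ∀ j ∈ Finset.range n \ A, n ≤ j + d ∧ j < n + d := by
    intro j hj
    have hj' : j < n ∧ j ∉ A := by simpa using hj
    refine ⟨?_, by omega⟩
    by_contra hlt
    exact hj'.2 (mem_of_sum_le hA hd (by omega))
  have hcard := card_sdiff_range hA
  rw [← h1, ← h2]
  constructor
  · calc I * U ≤ I * (b ^ (2 * d) * V) := by
          gcongr; exact ineq _ _ hr.symm hcard.symm hAbd hRbd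
      _ = _ := by ring
  · calc I * V ≤ I * (b ^ (2 * d) * U) := by
          gcongr; exact ineq _ _ hcard.symm hr.symm hRbd hAbd
      _ = _ := by ring

end LevelSets

/-! ### The Vandermonde determinant as vacuum, and its excitations -/

/-- The exponents of an alternating polynomial of controlled degree. -/
lemma IsAlternating.card_image {P : MvPolynomial (Fin n) ℂ} (hP : IsAlternating P)
    {m : Fin n → ℕ} (hm : coeffFn P m ≠ 0) :
    Function.Injective m ∧ (Finset.univ.image m).card = n := by
  have hinj : Function.Injective m := by
    by_contra h
    exact hm (hP.coeffFn_eq_zero h)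
  exact ⟨hinj, by rw [Finset.card_image_of_injective _ hinj]; simp⟩

lemma sum_le_totalDegree {P : MvPolynomial (Fin n) ℂ} {m : Fin n → ℕ} (hm : coeffFn P m ≠ 0) :
    ∑ i, m i ≤ P.totalDegree := by
  have h := MvPolynomial.le_totalDegree (p := P) (s := Finsupp.equivFunOnFinite.symm m)
    (MvPolynomial.mem_support_iff.mpr hm)
  rwa [Finsupp.sum_fintype _ _ (by simp)] at h

lemma IsAlternating.sum_image_le {P : MvPolynomial (Fin n) ℂ} (hP : IsAlternating P) {d : ℕ}
    (hd : P.totalDegree ≤ ∑ s ∈ Finset.range n, s + d) {m : Fin n → ℕ} (hm : coeffFn P m ≠ 0) :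
    ∑ a ∈ Finset.univ.image m, a ≤ ∑ s ∈ Finset.range n, s + d := by
  rw [Finset.sum_image fun i _ j _ h => (hP.card_image hm).1 h]
  exact (sum_le_totalDegree hm).trans hd

lemma IsAlternating.fillsLevels {P : MvPolynomial (Fin n) ℂ} (hP : IsAlternating P) {d D : ℕ}
    (hd : P.totalDegree ≤ ∑ s ∈ Finset.range n, s + d) (hD : D + d ≤ n) : FillsLevels D P := by
  intro m hm s hs
  simpa using mem_of_sum_le (hP.card_image hm).2 (hP.sum_image_le hd hm) (s := s) (by omega)

lemma IsAlternating.lt_of_coeffFn_ne_zero {P : MvPolynomial (Fin n) ℂ} (hP : IsAlternating P)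
    {d : ℕ} (hd : P.totalDegree ≤ ∑ s ∈ Finset.range n, s + d) {m : Fin n → ℕ}
    (hm : coeffFn P m ≠ 0) (i : Fin n) : m i < n + d :=
  lt_of_sum_le (hP.card_image hm).2 (hP.sum_image_le hd hm) (by simp)

/-- The Vandermonde determinant as a polynomial. -/
def vandermondePoly (n : ℕ) : MvPolynomial (Fin n) ℂ :=
  (Matrix.vandermonde fun i : Fin n => (MvPolynomial.X i : MvPolynomial (Fin n) ℂ)).det

lemma isAlternating_vandermondePoly : IsAlternating (vandermondePoly n) := by
  intro i j hij
  rw [vandermondePoly, AlgHom.map_det]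
  have : (MvPolynomial.rename (Equiv.swap i j)).mapMatrix
      (Matrix.vandermonde fun i : Fin n => (MvPolynomial.X i : MvPolynomial (Fin n) ℂ)) =
      (Matrix.vandermonde fun i : Fin n => (MvPolynomial.X i : MvPolynomial (Fin n) ℂ)).submatrix
        (Equiv.swap i j) id := by
    ext1 a b
    simp [Matrix.vandermonde_apply]
  rw [this, Matrix.det_permute, Equiv.Perm.sign_swap hij]
  simp

lemma totalDegree_vandermondePoly :
    (vandermondePoly n).totalDegree ≤ ∑ s ∈ Finset.range n, s := by
  rw [vandermondePoly, Matrix.det_apply]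
  refine MvPolynomial.totalDegree_finsetSum_le fun σ _ => ?_
  refine (MvPolynomial.totalDegree_smul_le _ _).trans ?_
  refine (MvPolynomial.totalDegree_finsetProd _ _).trans ?_
  rw [← Fin.sum_univ_eq_sum_range (fun s => s)]
  refine Finset.sum_le_sum fun i _ => ?_
  rw [Matrix.vandermonde_apply, MvPolynomial.totalDegree_X_pow]

lemma totalDegree_linStat (g : ℂ[X]) : (linStat n g).totalDegree ≤ g.natDegree := by
  rw [linStat_eq]
  refine MvPolynomial.totalDegree_finsetSum_le fun i _ => ?_
  refine MvPolynomial.totalDegree_finsetSum_le fun k hk => ?_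
  refine (MvPolynomial.totalDegree_smul_le _ _).trans ?_
  rw [MvPolynomial.totalDegree_X_pow]
  simp at hk
  omega

/-- The excited state `(∑ᵢ g(Xᵢ)) ^ p · Δ`. -/
def excited (n : ℕ) (g : ℂ[X]) (p : ℕ) : MvPolynomial (Fin n) ℂ :=
  linStat n g ^ p * vandermondePoly n

lemma excited_succ (g : ℂ[X]) (p : ℕ) : excited n g (p + 1) = linStat n g * excited n g p := by
  rw [excited, excited, pow_succ']
  ring

lemma isAlternating_excited (g : ℂ[X]) (p : ℕ) : IsAlternating (excited n g p) := by
  induction p with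
  | zero => simpa [excited] using isAlternating_vandermondePoly
  | succ p ih => rw [excited_succ]; exact ih.linStat_mul g

lemma totalDegree_excited (g : ℂ[X]) (p : ℕ) :
    (excited n g p).totalDegree ≤ ∑ s ∈ Finset.range n, s + p * g.natDegree := by
  induction p with
  | zero => simpa [excited] using totalDegree_vandermondePoly
  | succ p ih =>
    rw [excited_succ]
    refine (MvPolynomial.totalDegree_mul _ _).trans ?_
    have := totalDegree_linStat (n := n) g
    rw [add_mul]
    omega

/-- For injective `m` the sum of exponents is already at least the degree of `Δ`, so raising one
exponent by `k > 0` leaves the support of `Δ`. The condition on `g.coeff 0` removes `k = 0`, which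
would merely rescale `Δ`. -/
lemma lowering_vandermondePoly {g : ℂ[X]} (hg : g.coeff 0 = 0) :
    lowering g (vandermondePoly n) = 0 := by
  refine ext_coeffFn fun m => ?_
  rw [coeffFn_lowering, Finset.sum_comm]
  refine (Finset.sum_eq_zero fun k _ => ?_).trans (by simp [coeffFn])
  rw [← Finset.mul_sum]
  rcases Nat.eq_zero_or_pos k with rfl | hk
  · simp [hg]
  by_cases hm : Function.Injective m
  · rw [Finset.sum_eq_zero, mul_zero]
    intro i _
    by_contra hne
    have h1 := (sum_le_totalDegree hne).trans totalDegree_vandermondePoly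
    have h2 : ∑ s ∈ Finset.range n, s ≤ ∑ i, m i := by
      rw [← Finset.sum_image (s := Finset.univ) (g := m) (f := fun a => a)
        fun i _ j _ h => hm h]
      exact sum_range_le_sum (by rw [Finset.card_image_of_injective _ hm]; simp)
    rw [Finset.sum_update_of_mem (Finset.mem_univ i)] at h1
    rw [← Finset.add_sum_erase _ _ (Finset.mem_univ i), ← Finset.sdiff_singleton_eq_erase] at h2
    omega
  · have := isAlternating_vandermondePoly.sum_update_eq_zero (fun _ => 1) (fun a => a + k) hm
    simp only [one_mul] at this
    rw [this, mul_zero]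

/-- Each commutation past a factor of the linear statistic contributes one `energy g`, until the
lowering operator reaches the vacuum. The bound on `n` keeps the lowest `g.natDegree` levels filled
throughout. -/
lemma lowering_excited_succ {g : ℂ[X]} (hg : g.coeff 0 = 0) (q : ℕ)
    (hn : (q + 1) * g.natDegree ≤ n) :
    lowering g (excited n g (q + 1)) = (((q + 1 : ℕ) : ℂ) * energy g) • excited n g q := by
  induction q with
  | zero =>
    rw [excited_succ, lowering_linStat_mul (isAlternating_excited g 0)
      ((isAlternating_excited g 0).fillsLevels (totalDegree_excited g 0) (by linarith))]
    have : excited n g 0 = vandermondePoly n := by simp [excited]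
    rw [this, lowering_vandermondePoly hg]
    simp
  | succ q ih =>
    rw [excited_succ, lowering_linStat_mul (isAlternating_excited g _)
      ((isAlternating_excited g _).fillsLevels (totalDegree_excited g _) (by linarith)),
      ih (by linarith), mul_smul_comm, ← excited_succ, ← add_smul]
    congr 1
    push_cast
    ring

/-! ### Coefficient pairings and exact Gaussian moments for unit weights -/

/-- The pairing `∑ₘ w(m) Pₘ conj(Qₘ)` of the coefficients, as a linear form in `P`. -/
def pairing (w : (Fin n →₀ ℕ) → ℝ) (Q : MvPolynomial (Fin n) ℂ) :
    MvPolynomial (Fin n) ℂ →ₗ[ℂ] ℂ :=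
  (MvPolynomial.basisMonomials (Fin n) ℂ).constr ℂ fun m => conj (Q.coeff m) * w m

lemma pairing_monomial (w : (Fin n →₀ ℕ) → ℝ) (Q : MvPolynomial (Fin n) ℂ) (m : Fin n →₀ ℕ)
    (a : ℂ) : pairing w Q (MvPolynomial.monomial m a) = a * conj (Q.coeff m) * w m := by
  have : MvPolynomial.monomial m a = a • MvPolynomial.basisMonomials (Fin n) ℂ m := by
    rw [MvPolynomial.coe_basisMonomials, MvPolynomial.smul_monomial, smul_eq_mul, mul_one]
  rw [this, map_smul, pairing, Module.Basis.constr_basis, smul_eq_mul, mul_assoc]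

lemma pairing_eq_sum (w : (Fin n →₀ ℕ) → ℝ) (P Q : MvPolynomial (Fin n) ℂ)
    {s : Finset (Fin n →₀ ℕ)} (hs : P.support ⊆ s) :
    pairing w Q P = ∑ m ∈ s, P.coeff m * conj (Q.coeff m) * w m := by
  conv_lhs => rw [P.as_sum, map_sum]
  simp only [pairing_monomial]
  refine Finset.sum_subset hs fun m _ hm => ?_
  rw [MvPolynomial.notMem_support_iff.mp hm]
  simp

lemma pairing_conj (w : (Fin n →₀ ℕ) → ℝ) (P Q : MvPolynomial (Fin n) ℂ) :
    pairing w P Q = conj (pairing w Q P) := by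
  rw [pairing_eq_sum w Q P (s := P.support ∪ Q.support) Finset.subset_union_right,
    pairing_eq_sum w P Q (s := P.support ∪ Q.support) Finset.subset_union_left, map_sum]
  refine Finset.sum_congr rfl fun m _ => ?_
  rw [map_mul, map_mul, Complex.conj_conj, Complex.conj_ofReal]
  ring

lemma pairing_smul_right (w : (Fin n →₀ ℕ) → ℝ) (P Q : MvPolynomial (Fin n) ℂ) (c : ℂ) :
    pairing w (c • Q) P = conj c * pairing w Q P := by
  rw [pairing_conj, map_smul, smul_eq_mul, map_mul, ← pairing_conj]

lemma pairing_sum_right {ι : Type*} (w : (Fin n →₀ ℕ) → ℝ) (P : MvPolynomial (Fin n) ℂ)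
    (s : Finset ι) (Q : ι → MvPolynomial (Fin n) ℂ) :
    pairing w (∑ i ∈ s, Q i) P = ∑ i ∈ s, pairing w (Q i) P := by
  rw [pairing_conj, map_sum, map_sum]
  simp only [← pairing_conj]

lemma pairing_X_pow_mul (i : Fin n) (k : ℕ) (P Q : MvPolynomial (Fin n) ℂ) :
    pairing (fun _ => 1) Q (MvPolynomial.X i ^ k * P) =
      pairing (fun _ => 1) (Q.divMonomial (Finsupp.single i k)) P := by
  induction P using MvPolynomial.induction_on' with
  | monomial m a =>
    rw [MvPolynomial.X_pow_eq_monomial, MvPolynomial.monomial_mul, pairing_monomial,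
      pairing_monomial, MvPolynomial.coeff_divMonomial, one_mul]
  | add P₁ P₂ h₁ h₂ => rw [mul_add, map_add, map_add, h₁, h₂]

lemma pairing_linStat_mul (g : ℂ[X]) (P Q : MvPolynomial (Fin n) ℂ) :
    pairing (fun _ => 1) Q (linStat n g * P) = pairing (fun _ => 1) (lowering g Q) P := by
  simp only [linStat_eq, lowering, Finset.sum_mul, smul_mul_assoc, map_sum, map_smul,
    pairing_sum_right, pairing_smul_right, pairing_X_pow_mul, Complex.conj_conj, smul_eq_mul]

lemma pairing_excited_zero_left {g : ℂ[X]} (hg : g.coeff 0 = 0) (p : ℕ) :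
    pairing (fun _ => 1) (excited n g 0) (excited n g (p + 1)) = 0 := by
  have h0 : excited n g 0 = vandermondePoly n := by simp [excited]
  -- Linearity in the second polynomial is available through scalars only, so zero is written as a
  -- multiple.
  have hz : (0 : MvPolynomial (Fin n) ℂ) = (0 : ℂ) • 0 := by simp
  rw [excited_succ, pairing_linStat_mul, h0, lowering_vandermondePoly hg, hz, pairing_smul_right]
  simp

/-- The unweighted moments of a linear statistic are those of a complex Gaussian. -/
lemma pairing_excited {g : ℂ[X]} (hg : g.coeff 0 = 0) (p q : ℕ) (hn : q * g.natDegree ≤ n) :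
    pairing (fun _ => 1) (excited n g q) (excited n g p) =
      if p = q then (p.factorial * energy g ^ p : ℝ) *
        pairing (fun _ => 1) (vandermondePoly n) (vandermondePoly n) else 0 := by
  have h0 : excited n g 0 = vandermondePoly n := by simp [excited]
  induction p generalizing q with
  | zero =>
    cases q with
    | zero => simp [h0]
    | succ q => rw [pairing_conj, pairing_excited_zero_left hg]; simp
  | succ p ih =>
    cases q with
    | zero => rw [pairing_excited_zero_left hg]; simp
    | succ q =>
      rw [excited_succ g p, pairing_linStat_mul, lowering_excited_succ hg q hn,
        pairing_smul_right, ih q (by linarith)]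
      by_cases hpq : p = q
      · subst hpq
        simp only [if_true, Nat.factorial_succ, pow_succ]
        push_cast
        simp
        ring
      · simp [hpq]

lemma pairing_self_eq (P : MvPolynomial (Fin n) ℂ) :
    pairing (fun _ => 1) P P = (∑ m ∈ P.support, ‖P.coeff m‖ ^ 2 : ℝ) := by
  rw [pairing_eq_sum _ P P subset_rfl]
  push_cast
  refine Finset.sum_congr rfl fun m _ => ?_
  rw [Complex.mul_conj']
  simp

/-- Allows the true weights to be replaced by a constant: the error is controlled by unit-weight
norms, through `|a * b| ≤ |a| ^ 2 + |b| ^ 2`. Only exponents in the support of `P` matter. -/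
lemma norm_pairing_sub_le (w : (Fin n →₀ ℕ) → ℝ) (P Q : MvPolynomial (Fin n) ℂ) {c δ : ℝ}
    (hδ : 0 ≤ δ) (hw : ∀ m, P.coeff m ≠ 0 → |w m - c| ≤ δ) :
    ‖pairing w Q P - c * pairing (fun _ => 1) Q P‖ ≤
      δ * ((pairing (fun _ => 1) P P).re + (pairing (fun _ => 1) Q Q).re) := by
  have hP : (pairing (fun _ => 1) P P).re = ∑ m ∈ P.support, ‖P.coeff m‖ ^ 2 := by
    rw [pairing_self_eq, Complex.ofReal_re]
  have hQ : (pairing (fun _ => 1) Q Q).re = ∑ m ∈ Q.support, ‖Q.coeff m‖ ^ 2 := by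
    rw [pairing_self_eq, Complex.ofReal_re]
  rw [hP, hQ, pairing_eq_sum w P Q (s := P.support) subset_rfl,
    pairing_eq_sum _ P Q (s := P.support) subset_rfl, Finset.mul_sum, ← Finset.sum_sub_distrib]
  have hQ' : ∑ m ∈ P.support, ‖Q.coeff m‖ ^ 2 ≤ ∑ m ∈ Q.support, ‖Q.coeff m‖ ^ 2 := by
    refine (Finset.sum_le_sum_of_subset_of_nonneg (Finset.subset_union_left (s₂ := Q.support))
      fun m _ _ => by positivity).trans (le_of_eq ?_)
    refine (Finset.sum_subset Finset.subset_union_right fun m _ hm => ?_).symm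
    rw [MvPolynomial.notMem_support_iff.mp hm]
    simp
  calc _ ≤ ∑ m ∈ P.support, δ * (‖P.coeff m‖ ^ 2 + ‖Q.coeff m‖ ^ 2) := by
        refine norm_sum_le_of_le _ fun m hm => ?_
        have e : P.coeff m * conj (Q.coeff m) * w m - c * (P.coeff m * conj (Q.coeff m) * (1 : ℝ)) =
            P.coeff m * conj (Q.coeff m) * ((w m - c : ℝ) : ℂ) := by
          push_cast; ring
        rw [e, norm_mul, norm_mul, RCLike.norm_conj, Complex.norm_real, Real.norm_eq_abs, mul_comm]
        refine mul_le_mul (hw m (MvPolynomial.mem_support_iff.mp hm)) ?_ (by positivity) hδ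
        nlinarith [sq_nonneg (‖P.coeff m‖ - ‖Q.coeff m‖), sq_nonneg ‖P.coeff m‖,
          sq_nonneg ‖Q.coeff m‖]
    _ ≤ _ := by
        rw [← Finset.mul_sum, Finset.sum_add_distrib]
        gcongr

end AlternatingPolynomial

/-! ### Rotation invariance and the explicit projection kernel -/

/-- The moment `∫ |z| ^ (2 j) dμ`. -/
def evenMoment (μ : Measure ℂ) (j : ℕ) : ℝ := ∫ z, ‖z‖ ^ (2 * j) ∂μ

lemma IsRotationInvariant.integral_mul_conj_pow {μ : Measure ℂ} (hμ : IsRotationInvariant μ)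
    (a b : ℕ) : ∫ z, z ^ a * conj (z ^ b) ∂μ = if a = b then (evenMoment μ a : ℂ) else 0 := by
  split_ifs with hab
  · subst hab
    rw [evenMoment, ← integral_complex_ofReal]
    refine integral_congr_ae (Eventually.of_forall fun z => ?_)
    simp only
    rw [Complex.mul_conj', norm_pow]
    push_cast
    rw [← pow_mul, mul_comm a]
  · have hne : ((a : ℝ) - b) ≠ 0 := by
      rw [sub_ne_zero]
      exact_mod_cast hab
    -- Rotation by this angle multiplies the integrand by `exp (π * I) = -1`, so the integral is its
    -- own negative; integrability plays no role.
    set θ : ℝ := Real.pi / (a - b) with hθ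
    set c : ℂ := Complex.exp (θ * Complex.I) with hc
    have hc1 : ‖c‖ = 1 := Complex.norm_exp_ofReal_mul_I θ
    have hcc : c ^ a * conj (c ^ b) = -1 := by
      rw [hc, map_pow, ← Complex.exp_conj, ← Complex.exp_nat_mul, ← Complex.exp_nat_mul,
        ← Complex.exp_add, ← Complex.exp_pi_mul_I]
      congr 1
      simp only [map_mul, Complex.conj_ofReal, Complex.conj_I]
      have : (θ : ℂ) * ((a : ℂ) - b) = Real.pi := by
        rw [hθ]
        have h2 : ((a : ℂ) - b) ≠ 0 := by exact_mod_cast hne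
        push_cast
        field_simp
      linear_combination Complex.I * this
    have hmap : ∫ z, z ^ a * conj (z ^ b) ∂μ = ∫ z, (c * z) ^ a * conj ((c * z) ^ b) ∂μ := by
      conv_lhs => rw [← hμ c hc1]
      rw [integral_map (by fun_prop)]
      exact Continuous.aestronglyMeasurable (by fun_prop)
    have : ∫ z, (c * z) ^ a * conj ((c * z) ^ b) ∂μ = -∫ z, z ^ a * conj (z ^ b) ∂μ := by
      rw [← integral_neg]
      refine integral_congr_ae (Eventually.of_forall fun z => ?_)
      simp only [mul_pow, map_mul]
      linear_combination (z ^ a * conj (z ^ b)) * hcc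
    rw [this] at hmap
    exact self_eq_neg.mp hmap

section Kernel

variable {μ : Measure ℂ} {n : ℕ}

lemma eval_eq_sum_of_mem_degreeLT {p : ℂ[X]} (hp : p ∈ degreeLT ℂ n) (z : ℂ) :
    p.eval z = ∑ k ∈ Finset.range n, p.coeff k * z ^ k := by
  rw [mem_degreeLT] at hp
  rw [Polynomial.eval_eq_sum, Polynomial.sum_def]
  refine Finset.sum_subset (fun k hk => ?_) fun k _ hk => ?_
  · have h := (le_degree_of_mem_supp k hk).trans_lt hp
    simpa using h
  · rw [notMem_support_iff.mp hk, zero_mul]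

lemma integral_eval_mul_conj_pow (hμ : IsRotationInvariant μ)
    (hL : ∀ p ∈ degreeLT ℂ n, MemLp (fun z => p.eval z) 2 μ) {p : ℂ[X]} (hp : p ∈ degreeLT ℂ n)
    {j : ℕ} (hj : j < n) :
    ∫ z, p.eval z * conj (z ^ j) ∂μ = p.coeff j * evenMoment μ j := by
  have hmon : ∀ k < n, MemLp (fun z : ℂ => z ^ k) 2 μ := by
    intro k hk
    simpa using hL (X ^ k) (mem_degreeLT.mpr (by rw [degree_X_pow]; exact_mod_cast hk))
  simp only [eval_eq_sum_of_mem_degreeLT hp, Finset.sum_mul, mul_assoc]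
  rw [integral_finsetSum]
  · simp only [integral_const_mul, hμ.integral_mul_conj_pow]
    rw [Finset.sum_eq_single j]
    · simp
    · intro k _ hk
      simp [hk]
    · intro h
      simp at h
      omega
  · intro k hk
    exact ((hmon k (by simpa using hk)).integrable_mul (hmon j hj).star).const_mul _

lemma eq_zero_of_ae_eval_eq_zero (hμ : IsRotationInvariant μ)
    (hL : ∀ p ∈ degreeLT ℂ n, MemLp (fun z => p.eval z) 2 μ)
    (hpos : ∀ j < n, 0 < evenMoment μ j) {p : ℂ[X]} (hp : p ∈ degreeLT ℂ n)
    (h0 : ∀ j < n, ∫ z, p.eval z * conj (z ^ j) ∂μ = 0) : p = 0 := by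
  ext j
  rw [coeff_zero]
  by_cases hj : j < n
  · have h := integral_eval_mul_conj_pow hμ hL hp hj
    rw [h0 j hj] at h
    have := (hpos j hj).ne'
    simpa [this] using h.symm
  · exact coeff_eq_zero_of_degree_lt ((mem_degreeLT.mp hp).trans_le (by exact_mod_cast not_lt.mp hj))

/-- The explicit form of the projection kernel of a rotation invariant measure. -/
lemma IsPolynomialProjectionKernel.eq_sum {K : ℂ → ℂ → ℂ} (hK : IsPolynomialProjectionKernel μ n K)
    (hμ : IsRotationInvariant μ) (hpos : ∀ j < n, 0 < evenMoment μ j) (z w : ℂ) :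
    K z w = ∑ j : Fin n, z ^ (j : ℕ) * (evenMoment μ j : ℂ)⁻¹ * conj (w ^ (j : ℕ)) := by
  have hmon : ∀ k < n, (X ^ k : ℂ[X]) ∈ degreeLT ℂ n := fun k hk =>
    mem_degreeLT.mpr (by rw [degree_X_pow]; exact_mod_cast hk)
  choose p hp hKp using hK.polynomial
  have hproj : ∀ j < n, ∀ᵐ z ∂μ, ∫ w, K z w * w ^ j ∂μ = z ^ j := by
    intro j hj
    obtain ⟨q, hq, hae, horth⟩ := hK.projection (fun z => (X ^ j : ℂ[X]).eval z)
      (hK.memLp _ (hmon j hj))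
    have hzero : X ^ j - q = 0 := by
      refine eq_zero_of_ae_eval_eq_zero hμ hK.memLp hpos (Submodule.sub_mem _ (hmon j hj) hq)
        fun k hk => ?_
      simpa using horth (X ^ k) (hmon k hk)
    rw [← sub_eq_zero.mp hzero] at hae
    simpa using hae
  have hcoeff : ∀ j < n, ∀ᵐ z ∂μ, conj ((p z).coeff j) * evenMoment μ j = z ^ j := by
    intro j hj
    filter_upwards [hproj j hj] with z hz
    rw [← hz, ← Complex.conj_ofReal (evenMoment μ j), ← map_mul,
      ← integral_eval_mul_conj_pow hμ hK.memLp (hp z) hj, ← integral_conj]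
    refine integral_congr_ae (Eventually.of_forall fun w => ?_)
    simp only
    rw [map_mul, Complex.conj_conj, ← hKp, hK.hermitian z w, Complex.conj_conj]
  -- Interpolation at `n` nodes, together with the Hermitian symmetry, shows that the conjugated
  -- coefficients of `K(·, w)` are polynomials in `w` of degree less than `n`. The almost everywhere
  -- identity `hcoeff` is then one between polynomials, so it holds everywhere.
  let v : ℕ → ℂ := fun i => i
  have hv : Set.InjOn v (Finset.range n) := fun i _ j _ h => by simpa [v] using h
  have hinterp : ∀ w, p w = ∑ i ∈ Finset.range n,
      C (K (v i) w) * Lagrange.basis (Finset.range n) v i := by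
    intro w
    have hdeg : (p w).degree < (Finset.range n).card := by
      rw [Finset.card_range]
      exact mem_degreeLT.mp (hp w)
    rw [Lagrange.eq_interpolate hv hdeg, Lagrange.interpolate_apply]
    simp only [hKp]
  have hfin : ∀ j < n, ∀ w, (p w).coeff j = (evenMoment μ j : ℂ)⁻¹ * conj (w ^ j) := by
    intro j hj w
    have hne : (evenMoment μ j : ℂ) ≠ 0 := by exact_mod_cast (hpos j hj).ne'
    let r : ℂ[X] := ∑ i ∈ Finset.range n,
      (conj ((Lagrange.basis (Finset.range n) v i).coeff j) * evenMoment μ j) • p (v i) - X ^ j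
    have hr : ∀ u, r.eval u = conj ((p u).coeff j) * evenMoment μ j - u ^ j := by
      intro u
      simp only [r, eval_sub, eval_finsetSum, eval_smul, smul_eq_mul, eval_pow, eval_X]
      rw [hinterp u, finsetSum_coeff, map_sum, Finset.sum_mul]
      congr 1
      refine Finset.sum_congr rfl fun i _ => ?_
      rw [coeff_C_mul, map_mul, hK.hermitian u (v i), Complex.conj_conj, ← hKp]
      ring
    have hrmem : r ∈ degreeLT ℂ n :=
      Submodule.sub_mem _ (Submodule.sum_mem _ fun i _ => Submodule.smul_mem _ _ (hp _)) (hmon j hj)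
    have hr0 : r = 0 := by
      refine eq_zero_of_ae_eval_eq_zero hμ hK.memLp hpos hrmem fun k _ => ?_
      rw [integral_eq_zero_of_ae]
      filter_upwards [hcoeff j hj] with u hu
      simp [hr, hu]
    have h := hr w
    rw [hr0, eval_zero, eq_comm, sub_eq_zero] at h
    rw [← h, map_mul, Complex.conj_conj, Complex.conj_ofReal]
    field_simp
  rw [hKp, eval_eq_sum_of_mem_degreeLT (hp w), ← Fin.sum_univ_eq_sum_range
    (fun k => (p w).coeff k * z ^ k)]
  refine Finset.sum_congr rfl fun j _ => ?_
  rw [hfin j j.2]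
  ring

-- The kernel matrix factors as `V * D * Vᴴ` with `V` the Vandermonde matrix and `D` the diagonal
-- matrix of inverse moments.
open AlternatingPolynomial in
lemma IsPolynomialProjectionKernel.det_eq {K : ℂ → ℂ → ℂ}
    (hK : IsPolynomialProjectionKernel μ n K)
    (hμ : IsRotationInvariant μ) (hpos : ∀ j < n, 0 < evenMoment μ j) (x : Fin n → ℂ) :
    (Matrix.det (Matrix.of fun i j : Fin n => K (x i) (x j))).re =
      (∏ j ∈ Finset.range n, evenMoment μ j)⁻¹ *
        ‖MvPolynomial.eval x (vandermondePoly n)‖ ^ 2 := by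
  have hfac : (Matrix.of fun i j : Fin n => K (x i) (x j)) = Matrix.vandermonde x *
      Matrix.diagonal (fun j : Fin n => (evenMoment μ j : ℂ)⁻¹) *
      (Matrix.vandermonde x).conjTranspose := by
    ext i j
    rw [Matrix.mul_apply]
    simp only [Matrix.of_apply, hK.eq_sum hμ hpos, Matrix.mul_diagonal, Matrix.vandermonde_apply,
      Matrix.conjTranspose_apply, Complex.star_def]
  have heval : MvPolynomial.eval x (vandermondePoly n) = (Matrix.vandermonde x).det := by
    rw [vandermondePoly, RingHom.map_det]
    congr 1
    ext i j
    simp [Matrix.vandermonde_apply]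
  rw [hfac, Matrix.det_mul, Matrix.det_mul, Matrix.det_diagonal, Matrix.det_conjTranspose, heval,
    ← Finset.prod_range (fun j => (evenMoment μ j : ℂ)⁻¹), Complex.star_def]
  have : (Matrix.vandermonde x).det * (∏ j ∈ Finset.range n, (evenMoment μ j : ℂ)⁻¹) *
      conj (Matrix.vandermonde x).det =
      (((∏ j ∈ Finset.range n, evenMoment μ j)⁻¹ * ‖(Matrix.vandermonde x).det‖ ^ 2 : ℝ) : ℂ) := by
    push_cast
    rw [← Complex.mul_conj', Finset.prod_inv_distrib]
    ring
  rw [this, Complex.ofReal_re]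

end Kernel

/-! ### Laws of symmetric functions of the points -/

section Law

variable {Ω : Type*} [MeasurableSpace Ω] {P : Measure Ω} {n : ℕ} {z : Ω → Fin n → ℂ}
  {μ : Measure ℂ} {ρ : (Fin n → ℂ) → ℝ}

/-- For symmetric functions the `n`-point intensity determines the expectation. -/
lemma HasJointIntensity.lintegral_symmetric (h : HasJointIntensity P z μ n ρ)
    {φ : (Fin n → ℂ) → ℝ≥0∞} (hφ : Measurable φ)
    (hsymm : ∀ (σ : Equiv.Perm (Fin n)) x, φ (fun i => x (σ i)) = φ x) :
    ∫⁻ ω, φ (z ω) ∂P = (n.factorial : ℝ≥0∞)⁻¹ *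
      ∫⁻ x, φ x * ENNReal.ofReal (ρ x) ∂(Measure.pi fun _ : Fin n => μ) := by
  rw [← h φ hφ]
  have : ∀ ω, ∑ e : Fin n ↪ Fin n, φ (fun i => z ω (e i)) = (n.factorial : ℝ≥0∞) * φ (z ω) := by
    intro ω
    -- An embedding of a finite set into itself is a permutation, so all `n!` terms agree.
    have hterm : ∀ e : Fin n ↪ Fin n, φ (fun i => z ω (e i)) = φ (z ω) := fun e =>
      hsymm e.equivOfFiniteSelfEmbedding (z ω)
    simp only [hterm, Finset.sum_const, Finset.card_univ, Fintype.card_embedding_eq,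
      Fintype.card_fin, Nat.descFactorial_self, nsmul_eq_mul]
  simp only [this]
  rw [lintegral_const_mul' _ _ (ENNReal.natCast_ne_top _), ← mul_assoc, ENNReal.inv_mul_cancel
    (by exact_mod_cast n.factorial_ne_zero) (ENNReal.natCast_ne_top _), one_mul]

/-- The symmetrized law of the points. -/
def symmetricLaw (μ : Measure ℂ) (n : ℕ) (ρ : (Fin n → ℂ) → ℝ) : Measure (Fin n → ℂ) :=
  (n.factorial : ℝ≥0∞)⁻¹ •
    (Measure.pi fun _ : Fin n => μ).withDensity fun x => ENNReal.ofReal (ρ x)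

/-- The labelling is arbitrary, so the intensity does not determine the law of `z` itself, only that
of its symmetric functions. -/
lemma HasJointIntensity.map_symmetric {E : Type*} [MeasurableSpace E]
    (h : HasJointIntensity P z μ n ρ)
    (hz : AEMeasurable z P) {G : (Fin n → ℂ) → E} (hG : Measurable G)
    (hsymm : ∀ (σ : Equiv.Perm (Fin n)) x, G (fun i => x (σ i)) = G x) :
    P.map (fun ω => G (z ω)) = (symmetricLaw μ n ρ).map G := by
  ext A hA
  have hGz : AEMeasurable (fun ω => G (z ω)) P := hG.comp_aemeasurable hz
  rw [Measure.map_apply_of_aemeasurable hGz hA, Measure.map_apply hG hA]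
  have hm : Measurable ((G ⁻¹' A).indicator (1 : (Fin n → ℂ) → ℝ≥0∞)) :=
    measurable_one.indicator (hG hA)
  have hmem : ∀ (σ : Equiv.Perm (Fin n)) x, (fun i => x (σ i)) ∈ G ⁻¹' A ↔ x ∈ G ⁻¹' A :=
    fun σ x => by rw [Set.mem_preimage, Set.mem_preimage, hsymm]
  have h1 := h.lintegral_symmetric hm fun σ x => by
    by_cases hx : x ∈ G ⁻¹' A
    · rw [Set.indicator_of_mem hx, Set.indicator_of_mem ((hmem σ x).mpr hx)]
      rfl
    · rw [Set.indicator_of_notMem hx, Set.indicator_of_notMem (mt (hmem σ x).mp hx)]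
  have h2 : ∫⁻ ω, (G ⁻¹' A).indicator (1 : (Fin n → ℂ) → ℝ≥0∞) (z ω) ∂P =
      P ((fun ω => G (z ω)) ⁻¹' A) := by
    rw [← lintegral_map' hm.aemeasurable hz, lintegral_indicator_one (hG hA),
      Measure.map_apply_of_aemeasurable hz (hG hA)]
    rfl
  rw [← h2, h1, symmetricLaw, Measure.smul_apply, smul_eq_mul, withDensity_apply _ (hG hA),
    ← lintegral_indicator (hG hA)]
  congr 2
  ext x
  by_cases hx : G x ∈ A <;> simp [Set.indicator, hx]

end Law

/-! ### Orthogonality of monomials in the product space -/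

section Moments

open AlternatingPolynomial

variable {μ : Measure ℂ} {n : ℕ}

/-- The weight of an exponent in the pairing of `L²(μ ^ n)`. -/
def momentWeight (μ : Measure ℂ) (m : Fin n →₀ ℕ) : ℝ := ∏ i, evenMoment μ (m i)

lemma integrable_pow_mul_conj_pow [IsFiniteMeasure μ] {N : ℕ}
    (hN : Integrable (fun z : ℂ => ‖z‖ ^ (2 * N)) μ) {a b : ℕ} (ha : a ≤ N) (hb : b ≤ N) :
    Integrable (fun z : ℂ => z ^ a * conj (z ^ b)) μ := by
  refine Integrable.mono' ((integrable_const (1 : ℝ)).add hN)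
    (Continuous.aestronglyMeasurable (by fun_prop)) (Eventually.of_forall fun z => ?_)
  rw [norm_mul, RCLike.norm_conj, norm_pow, norm_pow, ← pow_add, Pi.add_apply]
  rcases le_total ‖z‖ 1 with h | h
  · exact (pow_le_one₀ (norm_nonneg _) h).trans (by simp)
  · have hab : a + b ≤ 2 * N := by omega
    exact (pow_le_pow_right₀ h hab).trans (by simp)

lemma integral_eval_mul_conj_eval [IsProbabilityMeasure μ] (hμ : IsRotationInvariant μ) {N : ℕ}
    (hN : Integrable (fun z : ℂ => ‖z‖ ^ (2 * N)) μ) {P Q : MvPolynomial (Fin n) ℂ}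
    (hP : ∀ m, P.coeff m ≠ 0 → ∀ i, m i ≤ N) (hQ : ∀ m, Q.coeff m ≠ 0 → ∀ i, m i ≤ N) :
    Integrable (fun x => MvPolynomial.eval x P * conj (MvPolynomial.eval x Q))
      (Measure.pi fun _ : Fin n => μ) ∧
    ∫ x, MvPolynomial.eval x P * conj (MvPolynomial.eval x Q) ∂(Measure.pi fun _ : Fin n => μ) =
      pairing (momentWeight μ) Q P := by
  have hexp : ∀ x, MvPolynomial.eval x P * conj (MvPolynomial.eval x Q) =
      ∑ m ∈ P.support, ∑ m' ∈ Q.support, (P.coeff m * conj (Q.coeff m')) *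
        ∏ i, (x i ^ m i * conj (x i ^ m' i)) := by
    intro x
    rw [MvPolynomial.eval_eq', MvPolynomial.eval_eq', map_sum, Finset.sum_mul_sum]
    refine Finset.sum_congr rfl fun m _ => Finset.sum_congr rfl fun m' _ => ?_
    rw [map_mul, map_prod, Finset.prod_mul_distrib]
    ring
  have hint : ∀ m ∈ P.support, ∀ m' ∈ Q.support, Integrable (fun x : Fin n → ℂ =>
      (P.coeff m * conj (Q.coeff m')) * ∏ i, (x i ^ m i * conj (x i ^ m' i)))
      (Measure.pi fun _ : Fin n => μ) := by
    intro m hm m' hm'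
    refine Integrable.const_mul ?_ _
    exact Integrable.fintype_prod (f := fun i (u : ℂ) => u ^ m i * conj (u ^ m' i)) fun i =>
      integrable_pow_mul_conj_pow hN (hP m (MvPolynomial.mem_support_iff.mp hm) i)
        (hQ m' (MvPolynomial.mem_support_iff.mp hm') i)
  simp only [hexp]
  refine ⟨integrable_finsetSum _ fun m hm => integrable_finsetSum _ fun m' hm' => hint m hm m' hm',
    ?_⟩
  rw [integral_finsetSum _ fun m hm => integrable_finsetSum _ fun m' hm' => hint m hm m' hm',
    pairing_eq_sum _ _ _ subset_rfl]
  refine Finset.sum_congr rfl fun m hm => ?_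
  rw [integral_finsetSum _ fun m' hm' => hint m hm m' hm']
  have hval : ∀ m' : Fin n →₀ ℕ, ∫ x : Fin n → ℂ, (P.coeff m * conj (Q.coeff m')) *
      ∏ i, (x i ^ m i * conj (x i ^ m' i)) ∂(Measure.pi fun _ : Fin n => μ) =
      if m = m' then P.coeff m * conj (Q.coeff m') * momentWeight μ m else 0 := by
    intro m'
    rw [integral_const_mul, integral_fintype_prod_eq_prod
      (f := fun i (u : ℂ) => u ^ m i * conj (u ^ m' i))]
    simp only [hμ.integral_mul_conj_pow]
    split_ifs with hmm
    · subst hmm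
      simp [momentWeight]
    · obtain ⟨i, hi⟩ : ∃ i, m i ≠ m' i := by
        by_contra! hcon
        exact hmm (Finsupp.ext hcon)
      rw [Finset.prod_eq_zero (Finset.mem_univ i) (by simp [hi]), mul_zero]
  simp only [hval]
  rw [Finset.sum_ite_eq]
  split_ifs with h
  · rfl
  · rw [MvPolynomial.notMem_support_iff.mp h]
    simp

end Moments

/-! ### Expectations of symmetric functions -/

section Transfer

variable {Ω : Type*} [MeasurableSpace Ω] {P : Measure Ω} {n : ℕ} {z : Ω → Fin n → ℂ}
  {μ : Measure ℂ} {ρ : (Fin n → ℂ) → ℝ}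

lemma HasJointIntensity.integral_symmetric
    (h : HasJointIntensity P z μ n ρ) (hρ : Measurable ρ) (hρ0 : ∀ x, 0 ≤ ρ x)
    (hz : AEMeasurable z P) {G : (Fin n → ℂ) → ℂ} (hG : Measurable G)
    (hsymm : ∀ (σ : Equiv.Perm (Fin n)) x, G (fun i => x (σ i)) = G x)
    (hint : Integrable (fun x => ρ x • G x) (Measure.pi fun _ : Fin n => μ)) :
    Integrable (fun ω => G (z ω)) P ∧
      ∫ ω, G (z ω) ∂P =
        (n.factorial : ℂ)⁻¹ * ∫ x, ρ x • G x ∂(Measure.pi fun _ : Fin n => μ) := by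
  have hmap := h.map_symmetric hz hG hsymm
  have hGz : AEMeasurable (fun ω => G (z ω)) P := hG.comp_aemeasurable hz
  have hmeas : Measurable fun x => ENNReal.ofReal (ρ x) := hρ.ennreal_ofReal
  have hlt : ∀ᵐ x ∂(Measure.pi fun _ : Fin n => μ), ENNReal.ofReal (ρ x) < ∞ :=
    Eventually.of_forall fun x => ENNReal.ofReal_lt_top
  have hint' : Integrable G (symmetricLaw μ n ρ) := by
    refine Integrable.smul_measure ?_ (ENNReal.inv_ne_top.mpr (by exact_mod_cast n.factorial_ne_zero))
    rw [integrable_withDensity_iff_integrable_smul' hmeas hlt]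
    simpa only [ENNReal.toReal_ofReal (hρ0 _)] using hint
  constructor
  · have h1 : Integrable (fun u : ℂ => u) ((symmetricLaw μ n ρ).map G) :=
      (integrable_map_measure aestronglyMeasurable_id hG.aemeasurable).mpr hint'
    rw [← hmap] at h1
    exact (integrable_map_measure aestronglyMeasurable_id hGz).mp h1
  · have h1 : ∫ ω, G (z ω) ∂P = ∫ u, u ∂(P.map fun ω => G (z ω)) :=
      (integral_map hGz aestronglyMeasurable_id).symm
    have h2 : ∫ u, u ∂((symmetricLaw μ n ρ).map G) = ∫ x, G x ∂(symmetricLaw μ n ρ) :=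
      integral_map hG.aemeasurable aestronglyMeasurable_id
    rw [h1, hmap, h2, symmetricLaw, integral_smul_measure, integral_withDensity_eq_integral_toReal_smul hmeas hlt]
    simp only [ENNReal.toReal_ofReal (hρ0 _)]
    simp

end Transfer

/-! ### Moments and integrability for fixed `n` -/

section FixedSize

open AlternatingPolynomial

variable {Ω : Type*} [MeasurableSpace Ω] {P : Measure Ω} {n : ℕ} {z : Ω → Fin n → ℂ}
  {μ : Measure ℂ}

/-- The density of the point process, normalized by the moments. -/
def processDensity (μ : Measure ℂ) (n : ℕ) (x : Fin n → ℂ) : ℝ :=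
  (∏ j ∈ Finset.range n, evenMoment μ j)⁻¹ * ‖MvPolynomial.eval x (vandermondePoly n)‖ ^ 2

lemma continuous_processDensity : Continuous (processDensity μ n) := by
  unfold processDensity
  have := MvPolynomial.continuous_eval (vandermondePoly n)
  fun_prop

lemma processDensity_nonneg (hpos : ∀ j < n, 0 < evenMoment μ j) (x : Fin n → ℂ) :
    0 ≤ processDensity μ n x := by
  have : 0 < ∏ j ∈ Finset.range n, evenMoment μ j :=
    Finset.prod_pos fun j hj => hpos j (by simpa using hj)
  unfold processDensity
  positivity

lemma IsSPPProcess.hasJointIntensity (h : IsSPPProcess P μ n z)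
    (hpos : ∀ j < n, 0 < evenMoment μ j) : HasJointIntensity P z μ n (processDensity μ n) := by
  obtain ⟨K, hK, hJ⟩ := h.jointIntensity
  have : (fun x : Fin n → ℂ => (Matrix.det (Matrix.of fun i j : Fin n => K (x i) (x j))).re) =
      processDensity μ n := by
    ext x
    rw [hK.det_eq h.rotationInvariant hpos, processDensity]
  rwa [this] at hJ

lemma eval_linStat (g : ℂ[X]) (x : Fin n → ℂ) :
    MvPolynomial.eval x (linStat n g) = ∑ k, g.eval (x k) := by
  rw [linStat, map_sum]
  refine Finset.sum_congr rfl fun k _ => ?_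
  rw [Polynomial.aeval_eq_sum_range, Polynomial.eval_eq_sum_range, map_sum]
  simp

lemma excited_exponent_le {g : ℂ[X]} {p N : ℕ} (hN : n + p * g.natDegree ≤ N + 1)
    (m : Fin n →₀ ℕ) (hm : (excited n g p).coeff m ≠ 0) (i : Fin n) : m i ≤ N := by
  rw [← coeffFn_coe] at hm
  have := (isAlternating_excited g p).lt_of_coeffFn_ne_zero (totalDegree_excited g p) hm i
  omega

lemma IsSPPProcess.integral_linStat_pow (h : IsSPPProcess P μ n z)
    (hpos : ∀ j < n, 0 < evenMoment μ j) (g : ℂ[X]) {p q N : ℕ}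
    (hint : Integrable (fun u : ℂ => ‖u‖ ^ (2 * N)) μ)
    (hp : n + p * g.natDegree ≤ N + 1) (hq : n + q * g.natDegree ≤ N + 1) :
    Integrable (fun ω => (∑ k, g.eval (z ω k)) ^ p * conj (∑ k, g.eval (z ω k)) ^ q) P ∧
    ∫ ω, (∑ k, g.eval (z ω k)) ^ p * conj (∑ k, g.eval (z ω k)) ^ q ∂P =
      ((n.factorial * ∏ j ∈ Finset.range n, evenMoment μ j : ℝ) : ℂ)⁻¹ *
        pairing (momentWeight μ) (excited n g q) (excited n g p) := by
  have := h.isProbabilityMeasure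
  obtain ⟨hI, hE⟩ := integral_eval_mul_conj_eval (n := n) h.rotationInvariant hint
    (excited_exponent_le hp) (excited_exponent_le hq)
  set W : ℝ := ∏ j ∈ Finset.range n, evenMoment μ j with hW
  have hkey : ∀ x : Fin n → ℂ, processDensity μ n x •
      ((∑ k, g.eval (x k)) ^ p * conj (∑ k, g.eval (x k)) ^ q) =
      (W : ℂ)⁻¹ * (MvPolynomial.eval x (excited n g p) *
        conj (MvPolynomial.eval x (excited n g q))) := by
    intro x
    rw [processDensity, ← hW, excited, excited, map_mul, map_mul, map_pow, map_pow, eval_linStat,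
      Complex.real_smul]
    push_cast
    rw [← Complex.mul_conj']
    simp only [map_mul, map_pow]
    ring
  have hmeas : Measurable fun x : Fin n → ℂ =>
      (∑ k, g.eval (x k)) ^ p * conj (∑ k, g.eval (x k)) ^ q := by
    refine Continuous.measurable ?_
    have := g.continuous
    fun_prop
  obtain ⟨h1, h2⟩ := (h.hasJointIntensity hpos).integral_symmetric
    continuous_processDensity.measurable (processDensity_nonneg hpos) h.aemeasurable hmeas
    (fun σ x => by rw [Equiv.sum_comp σ fun k => g.eval (x k)])
    (by simp only [hkey]; exact hI.const_mul _)
  refine ⟨h1, ?_⟩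
  rw [h2]
  simp only [hkey]
  rw [integral_const_mul, hE]
  push_cast
  rw [mul_inv, mul_assoc]

lemma integrable_pow_of_le [IsFiniteMeasure μ] {M N : ℕ} (hMN : M ≤ N)
    (hN : Integrable (fun u : ℂ => ‖u‖ ^ (2 * N)) μ) :
    Integrable (fun u : ℂ => ‖u‖ ^ (2 * M)) μ := by
  refine (integrable_pow_mul_conj_pow hN hMN hMN).norm.congr (Eventually.of_forall fun u => ?_)
  simp only [norm_mul, RCLike.norm_conj, norm_pow]
  ring

lemma norm_eval_le (f : ℂ[X]) (u : ℂ) :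
    ‖f.eval u‖ ≤ (∑ k ∈ Finset.range (f.natDegree + 1), ‖f.coeff k‖) *
      (1 + ‖u‖ ^ (2 * f.natDegree)) := by
  rw [Polynomial.eval_eq_sum_range, Finset.sum_mul]
  refine norm_sum_le_of_le _ fun k hk => ?_
  rw [norm_mul, norm_pow]
  refine mul_le_mul_of_nonneg_left ?_ (norm_nonneg _)
  have hk' : k ≤ 2 * f.natDegree := by simp at hk; omega
  rcases le_total ‖u‖ 1 with h | h
  · exact (pow_le_one₀ (norm_nonneg _) h).trans (by simp)
  · exact (pow_le_pow_right₀ h hk').trans (by simp)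

/-- A function of a single labelled point is not symmetric, so it is dominated by a constant
multiple of one plus the symmetric sum of `|z k| ^ (2 * d)`. Writing each summand as `z ^ d * conj
(z ^ d)` reduces integrability to that of monomial pairings. -/
lemma IsSPPProcess.integrable_eval (h : IsSPPProcess P μ n z) [IsProbabilityMeasure P]
    (hpos : ∀ j < n, 0 < evenMoment μ j) (f : ℂ[X])
    (hint : Integrable (fun u : ℂ => ‖u‖ ^ (2 * (n + f.natDegree))) μ) (k : Fin n) :
    Integrable (fun ω => f.eval (z ω k)) P := by
  have := h.isProbabilityMeasure
  set d := f.natDegree with hd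
  set W : ℝ := ∏ j ∈ Finset.range n, evenMoment μ j with hW
  have hexp : ∀ (k : Fin n) (m : Fin n →₀ ℕ),
      (MvPolynomial.X k ^ d * vandermondePoly n).coeff m ≠ 0 → ∀ i, m i ≤ n + d := by
    intro k m hm i
    rw [← coeffFn_coe, coeffFn_X_pow_mul] at hm
    split_ifs at hm with hdm
    · have := isAlternating_vandermondePoly.lt_of_coeffFn_ne_zero (d := 0)
        (by simpa using totalDegree_vandermondePoly) hm i
      rcases eq_or_ne i k with rfl | hik
      · rw [Function.update_self] at this
        omega
      · rw [Function.update_of_ne hik] at this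
        omega
    · exact absurd rfl hm
  have hkey : ∀ x : Fin n → ℂ, processDensity μ n x • ∑ k, x k ^ d * conj (x k ^ d) =
      ∑ k, (W : ℂ)⁻¹ * (MvPolynomial.eval x (MvPolynomial.X k ^ d * vandermondePoly n) *
        conj (MvPolynomial.eval x (MvPolynomial.X k ^ d * vandermondePoly n))) := by
    intro x
    rw [Finset.smul_sum]
    refine Finset.sum_congr rfl fun k _ => ?_
    rw [processDensity, ← hW, Complex.real_smul]
    push_cast
    rw [← Complex.mul_conj']
    simp only [map_mul, map_pow, MvPolynomial.eval_X]
    ring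
  have h1 := ((h.hasJointIntensity hpos).integral_symmetric
    continuous_processDensity.measurable (processDensity_nonneg hpos) h.aemeasurable
    (G := fun x => ∑ k, x k ^ d * conj (x k ^ d))
    (Continuous.measurable (by fun_prop))
    (fun σ x => Equiv.sum_comp σ fun k => x k ^ d * conj (x k ^ d))
    (by
      simp only [hkey]
      exact integrable_finsetSum _ fun k _ => (integral_eval_mul_conj_eval h.rotationInvariant
        hint (hexp k) (hexp k)).1.const_mul _)).1
  have hsum : Integrable (fun ω => (∑ k ∈ Finset.range (d + 1), ‖f.coeff k‖) *
      (1 + ‖∑ k, z ω k ^ d * conj (z ω k ^ d)‖)) P :=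
    ((integrable_const (1 : ℝ)).add h1.norm).const_mul _
  have hzk : AEMeasurable (fun ω => z ω k) P := (measurable_pi_apply k).comp_aemeasurable h.aemeasurable
  refine hsum.mono' (f.continuous.measurable.comp_aemeasurable hzk).aestronglyMeasurable
    (Eventually.of_forall fun ω => ?_)
  refine (norm_eval_le f (z ω k)).trans ?_
  gcongr
  have : ∑ k, z ω k ^ d * conj (z ω k ^ d) = ((∑ k, ‖z ω k‖ ^ (2 * d) : ℝ) : ℂ) := by
    push_cast
    refine Finset.sum_congr rfl fun k _ => ?_
    rw [Complex.mul_conj', norm_pow]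
    push_cast
    ring
  rw [this, Complex.norm_real, Real.norm_of_nonneg (Finset.sum_nonneg fun k _ => by positivity)]
  exact Finset.single_le_sum (f := fun k => ‖z ω k‖ ^ (2 * d)) (fun k _ => by positivity)
    (Finset.mem_univ k)

end FixedSize

/-! ### Asymptotics of the mixed moments -/

section Asymptotics

open AlternatingPolynomial

variable {n : ℕ}

lemma momentWeight_eq_prod_image (μ : Measure ℂ) {m : Fin n →₀ ℕ} (hm : Function.Injective m) :
    momentWeight μ m = ∏ a ∈ Finset.univ.image m, evenMoment μ a := by
  rw [momentWeight, Finset.prod_image fun i _ j _ h => hm h]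

lemma abs_momentWeight_sub_le {μ : Measure ℂ} {P : MvPolynomial (Fin n) ℂ} (hP : IsAlternating P)
    {d : ℕ} (hd : P.totalDegree ≤ ∑ s ∈ Finset.range n, s + d)
    (hpos : ∀ j, j < n + d → 0 < evenMoment μ j) {c b : ℝ} (hc : 0 < c) (hb : 1 ≤ b)
    (hh : ∀ j, n ≤ j + d → j < n + d → evenMoment μ j ≤ b * c ∧ c ≤ b * evenMoment μ j)
    {m : Fin n →₀ ℕ} (hm : P.coeff m ≠ 0) :
    |momentWeight μ m - ∏ j ∈ Finset.range n, evenMoment μ j| ≤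
      (b ^ (2 * d) - 1) * ∏ j ∈ Finset.range n, evenMoment μ j := by
  rw [← coeffFn_coe] at hm
  obtain ⟨hinj, hcard⟩ := hP.card_image hm
  rw [momentWeight_eq_prod_image μ hinj]
  obtain ⟨h1, h2⟩ := prod_ratio_bound hcard (hP.sum_image_le hd hm) hpos hc hb hh
  have hA : 0 < ∏ a ∈ Finset.univ.image m, evenMoment μ a := Finset.prod_pos fun a ha =>
    hpos a (lt_of_sum_le hcard (hP.sum_image_le hd hm) ha)
  have hW : 0 < ∏ j ∈ Finset.range n, evenMoment μ j := Finset.prod_pos fun a ha =>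
    hpos a (by simp at ha; omega)
  set A := ∏ a ∈ Finset.univ.image m, evenMoment μ a
  set W := ∏ j ∈ Finset.range n, evenMoment μ j
  have hB : 1 ≤ b ^ (2 * d) := one_le_pow₀ hb
  rw [abs_le]
  constructor
  · by_contra hlt
    have hAW : A < W := by nlinarith
    nlinarith [mul_nonneg (sub_nonneg.mpr hB) (sub_nonneg.mpr hAW.le)]
  · linarith

/-- The moments of order about `2n` exist, are positive and have ratios close to one. -/
def RegularMoments (μ : ℕ → Measure ℂ) : Prop :=
  ∀ (d : ℕ) (b : ℝ), 1 < b → ∀ᶠ n in atTop,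
    Integrable (fun u : ℂ => ‖u‖ ^ (2 * (n + d))) (μ n) ∧
    (∀ j, j ≤ n + d → 0 < evenMoment (μ n) j) ∧
    ∀ j, n ≤ j + d → j < n + d → evenMoment (μ n) j ≤ b * evenMoment (μ n) n ∧
      evenMoment (μ n) n ≤ b * evenMoment (μ n) j

/-- This is the normalization of the process: total mass one is the case `p = q = 0` of the moment
formula. -/
lemma pairing_vandermondePoly {Ω : Type*} [MeasurableSpace Ω] {P : Measure Ω}
    [IsProbabilityMeasure P] {z : Ω → Fin n → ℂ} {μ : Measure ℂ} (h : IsSPPProcess P μ n z)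
    (hpos : ∀ j < n, 0 < evenMoment μ j) (hint : Integrable (fun u : ℂ => ‖u‖ ^ (2 * n)) μ) :
    pairing (fun _ => 1) (vandermondePoly n) (vandermondePoly n) = n.factorial := by
  have h1 := (h.integral_linStat_pow hpos 0 (p := 0) (q := 0) hint (by simp) (by simp)).2
  have hW : 0 < ∏ j ∈ Finset.range n, evenMoment μ j := Finset.prod_pos fun a ha =>
    hpos a (by simpa using ha)
  have h0 : excited n 0 0 = vandermondePoly n := by simp [excited]
  -- With `d = 0` every exponent of `Δ` permutes `0, …, n - 1`, so its weight is exactly `W` and the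
  -- error vanishes; `b = c = 1` is a vacuous choice.
  have h2 := norm_pairing_sub_le (momentWeight μ) (vandermondePoly n) (vandermondePoly n) le_rfl
    (c := ∏ j ∈ Finset.range n, evenMoment μ j) fun m hm => by
      simpa using abs_momentWeight_sub_le isAlternating_vandermondePoly (d := 0)
        (by simpa using totalDegree_vandermondePoly) hpos one_pos le_rfl
        (fun j hj hj' => by omega) hm
  rw [zero_mul, norm_le_zero_iff, sub_eq_zero] at h2
  rw [h0, h2] at h1
  have hW' : ((∏ j ∈ Finset.range n, evenMoment μ j : ℝ) : ℂ) ≠ 0 := by exact_mod_cast hW.ne'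
  have hn : (n.factorial : ℂ) ≠ 0 := by exact_mod_cast n.factorial_ne_zero
  rw [Complex.ofReal_mul, Complex.ofReal_natCast] at h1
  simp only [pow_zero, mul_one, integral_const, probReal_univ, one_smul] at h1
  field_simp at h1
  exact h1.symm

theorem tendsto_integral_linStat_pow {Ω : ℕ → Type*} [∀ n, MeasurableSpace (Ω n)]
    {P : (n : ℕ) → Measure (Ω n)} [∀ n, IsProbabilityMeasure (P n)] {μ : ℕ → Measure ℂ}
    {z : (n : ℕ) → Ω n → Fin n → ℂ} (hz : ∀ n, 1 ≤ n → IsSPPProcess (P n) (μ n) n (z n))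
    (hμ : RegularMoments μ) {g : ℂ[X]} (hg : g.coeff 0 = 0) (p q : ℕ) :
    Tendsto (fun n => ∫ ω, (∑ k, g.eval (z n ω k)) ^ p * conj (∑ k, g.eval (z n ω k)) ^ q ∂(P n))
      atTop (𝓝 (if p = q then ((p.factorial * energy g ^ p : ℝ) : ℂ) else 0)) := by
  set d := max p q * g.natDegree with hd
  set M : ℝ := p.factorial * energy g ^ p + q.factorial * energy g ^ q with hM
  rw [Metric.tendsto_nhds]
  intro ε hε
  -- The relative error of the weights is `b ^ (2 * d) - 1`, and `M` bounds the normalized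
  -- unit-weight norms; `b` is chosen before `n`.
  obtain ⟨b, hb1, hbε⟩ : ∃ b : ℝ, 1 < b ∧ (b ^ (2 * d) - 1) * M < ε := by
    have hcont : ContinuousAt (fun b : ℝ => (b ^ (2 * d) - 1) * M) 1 := by fun_prop
    have h1 : ∀ᶠ b in 𝓝[>] (1 : ℝ), (b ^ (2 * d) - 1) * M < ε :=
      nhdsWithin_le_nhds (hcont.eventually_lt continuousAt_const (by simpa using hε))
    obtain ⟨b, hb⟩ := (h1.and self_mem_nhdsWithin).exists
    exact ⟨b, hb.2, hb.1⟩
  filter_upwards [hμ d b hb1, eventually_ge_atTop 1, eventually_ge_atTop d] with n hn hn1 hnd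
  obtain ⟨hint, hpos, hratio⟩ := hn
  have hS := hz n hn1
  have hprob := hS.isProbabilityMeasure
  have hpos' : ∀ j < n, 0 < evenMoment (μ n) j := fun j hj => hpos j (by omega)
  have hpd : p * g.natDegree ≤ d := Nat.mul_le_mul_right _ (le_max_left p q)
  have hqd : q * g.natDegree ≤ d := Nat.mul_le_mul_right _ (le_max_right p q)
  rw [(hS.integral_linStat_pow hpos' g hint (p := p) (q := q) (by omega) (by omega)).2]
  have hΔ := pairing_vandermondePoly hS hpos' (integrable_pow_of_le (by omega) hint)
  set W : ℝ := ∏ j ∈ Finset.range n, evenMoment (μ n) j with hWdef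
  have hW : 0 < W := Finset.prod_pos fun a ha => hpos' a (by simpa using ha)
  have hpq := pairing_excited hg p q (n := n) (by omega)
  have hpp := pairing_excited hg p p (n := n) (by omega)
  have hqq := pairing_excited hg q q (n := n) (by omega)
  rw [hΔ] at hpq hpp hqq
  simp only [if_true] at hpp hqq
  have hb0 : 0 ≤ b ^ (2 * d) - 1 := sub_nonneg.mpr (one_le_pow₀ hb1.le)
  have hbound := norm_pairing_sub_le (momentWeight (μ n)) (excited n g p) (excited n g q)
    (c := W) (δ := (b ^ (2 * d) - 1) * W) (by positivity)
    fun m hm => abs_momentWeight_sub_le (isAlternating_excited g p)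
      ((totalDegree_excited g p).trans (by omega)) (fun j hj => hpos j hj.le)
      (hpos n (by omega)) hb1.le hratio hm
  rw [hpp, hqq, ← Complex.ofReal_natCast, ← Complex.ofReal_mul, ← Complex.ofReal_mul,
    Complex.ofReal_re, Complex.ofReal_re] at hbound
  have hnf : (0 : ℝ) < n.factorial := by exact_mod_cast n.factorial_pos
  have hnW : ((n.factorial * W : ℝ) : ℂ) ≠ 0 := by exact_mod_cast (by positivity : n.factorial * W ≠ 0)
  have hlim : (if p = q then ((p.factorial * energy g ^ p : ℝ) : ℂ) else 0) =
      ((n.factorial * W : ℝ) : ℂ)⁻¹ *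
        (W * pairing (fun _ => 1) (excited n g q) (excited n g p)) := by
    rw [eq_inv_mul_iff_mul_eq₀ hnW, hpq]
    split_ifs
    · push_cast
      ring
    · simp
  rw [hlim, dist_eq_norm, ← mul_sub, norm_mul, norm_inv, Complex.norm_real,
    Real.norm_of_nonneg (by positivity)]
  calc _ ≤ (n.factorial * W)⁻¹ * ((b ^ (2 * d) - 1) * W *
        (p.factorial * energy g ^ p * n.factorial + q.factorial * energy g ^ q * n.factorial)) := by
        gcongr
    _ = (b ^ (2 * d) - 1) * M := by
        rw [hM]
        field_simp
    _ < ε := hbε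

end Asymptotics

/-! ### Taylor remainder of `exp (x * I)` -/

section Taylor

lemma norm_exp_mul_I_sub_sum_le_of_nonneg (N : ℕ) {x : ℝ} (hx : 0 ≤ x) :
    ‖Complex.exp (x * Complex.I) -
      ∑ k ∈ Finset.range N, (x * Complex.I) ^ k / (k.factorial : ℂ)‖ ≤ x ^ N / N.factorial := by
  induction N generalizing x with
  | zero => simp [Complex.norm_exp_ofReal_mul_I]
  | succ N ih =>
    have hder : ∀ y : ℝ, HasDerivAt (fun y : ℝ => Complex.exp (y * Complex.I) -
        ∑ k ∈ Finset.range (N + 1), (y * Complex.I) ^ k / (k.factorial : ℂ))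
        ((Complex.exp (y * Complex.I) -
          ∑ k ∈ Finset.range N, (y * Complex.I) ^ k / (k.factorial : ℂ)) * Complex.I) y := by
      intro y
      have h1 : HasDerivAt (fun y : ℝ => (y : ℂ) * Complex.I) Complex.I y := by
        simpa using (Complex.ofRealCLM.hasDerivAt (x := y)).mul_const Complex.I
      have h2 : HasDerivAt (fun y : ℝ => ∑ k ∈ Finset.range (N + 1),
          (y * Complex.I) ^ k / (k.factorial : ℂ)) (∑ k ∈ Finset.range (N + 1),
          ((k : ℂ) * (y * Complex.I) ^ (k - 1) * Complex.I) / (k.factorial : ℂ)) y :=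
        HasDerivAt.fun_sum fun k _ => (h1.fun_pow k).div_const _
      refine ((h1.cexp).fun_sub h2).congr_deriv ?_
      rw [sub_mul, Finset.sum_range_succ', Finset.sum_mul]
      congr 1
      simp only [Nat.cast_zero, zero_mul, zero_div, add_zero]
      refine Finset.sum_congr rfl fun k _ => ?_
      rw [Nat.add_sub_cancel, Nat.factorial_succ]
      have : (k.factorial : ℂ) ≠ 0 := by exact_mod_cast k.factorial_ne_zero
      have : ((k : ℂ) + 1) ≠ 0 := by exact_mod_cast k.succ_ne_zero
      push_cast
      field_simp
    have hB : ∀ y : ℝ, HasDerivAt (fun y : ℝ => y ^ (N + 1) / ((N + 1).factorial : ℝ))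
        (y ^ N / N.factorial) y := by
      intro y
      refine ((hasDerivAt_pow (N + 1) y).div_const ((N + 1).factorial : ℝ)).congr_deriv ?_
      rw [Nat.add_sub_cancel, Nat.factorial_succ]
      have : (N.factorial : ℝ) ≠ 0 := by exact_mod_cast N.factorial_ne_zero
      push_cast
      field_simp
    refine image_norm_le_of_norm_deriv_right_le_deriv_boundary (a := 0) (b := x)
      (fun y _ => (hder y).continuousAt.continuousWithinAt)
      (fun y _ => (hder y).hasDerivWithinAt) ?_ hB (fun y hy => ?_) (Set.right_mem_Icc.mpr hx)
    · rw [Finset.sum_range_succ']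
      simp
    · rw [norm_mul, Complex.norm_I, mul_one]
      exact ih hy.1

lemma norm_exp_mul_I_sub_sum_le (N : ℕ) (x : ℝ) :
    ‖Complex.exp (x * Complex.I) -
      ∑ k ∈ Finset.range N, (x * Complex.I) ^ k / (k.factorial : ℂ)‖ ≤ |x| ^ N / N.factorial := by
  rcases le_total 0 x with hx | hx
  · rw [abs_of_nonneg hx]
    exact norm_exp_mul_I_sub_sum_le_of_nonneg N hx
  · rw [abs_of_nonpos hx, ← Complex.norm_conj]
    refine (le_of_eq ?_).trans (norm_exp_mul_I_sub_sum_le_of_nonneg N (neg_nonneg.mpr hx))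
    rw [map_sub, map_sum, ← Complex.exp_conj]
    simp

end Taylor

/-! ### Convergence of characteristic functions from moments -/

section MethodOfMoments

variable {Ω : ℕ → Type*} [∀ n, MeasurableSpace (Ω n)] {P : (n : ℕ) → Measure (Ω n)}
  [∀ n, IsProbabilityMeasure (P n)]

/-- The moments of the real part of `conj t * Z` for a complex Gaussian `Z` of variance `v`. -/
def gaussianProjMoment (v : ℝ) (t : ℂ) (k : ℕ) : ℂ :=
  (2 ^ k)⁻¹ * ∑ i ∈ Finset.range (k + 1), (k.choose i : ℂ) * conj t ^ i * t ^ (k - i) *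
    if i = k - i then ((i.factorial * v ^ i : ℝ) : ℂ) else 0

lemma gaussianProjMoment_even (v : ℝ) (t : ℂ) (r : ℕ) :
    gaussianProjMoment v t (2 * r) =
      (2 * r).factorial / r.factorial * (‖t‖ ^ 2 * v / 4 : ℝ) ^ r := by
  rw [gaussianProjMoment, Finset.sum_eq_single r]
  · have h1 : 2 * r - r = r := by omega
    have h2 := Nat.choose_mul_factorial_mul_factorial (n := 2 * r) (k := r) (by omega)
    rw [h1] at h2 ⊢
    have h3 : (r.factorial : ℂ) ≠ 0 := by exact_mod_cast r.factorial_ne_zero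
    have h4 : conj t ^ r * t ^ r = (‖t‖ ^ 2 : ℂ) ^ r := by
      rw [← mul_pow, Complex.conj_mul']
    rw [if_pos rfl, ← h2]
    push_cast
    rw [mul_assoc ((2 * r).choose r : ℂ), h4, div_pow, mul_pow]
    have h5 : (4 : ℂ) ^ r = 2 ^ (2 * r) := by rw [pow_mul]; norm_num
    rw [h5]
    field_simp
  · intro i hi hne
    have : i ≠ 2 * r - i := by simp at hi; omega
    simp [this]
  · intro h
    simp at h
    omega

lemma gaussianProjMoment_odd (v : ℝ) (t : ℂ) (r : ℕ) :
    gaussianProjMoment v t (2 * r + 1) = 0 := by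
  rw [gaussianProjMoment, Finset.sum_eq_zero, mul_zero]
  intro i hi
  have : i ≠ 2 * r + 1 - i := by simp at hi; omega
  simp [this]

lemma sum_gaussianProjMoment (v : ℝ) (t : ℂ) (R : ℕ) :
    ∑ k ∈ Finset.range (2 * R), Complex.I ^ k / (k.factorial : ℂ) * gaussianProjMoment v t k =
      ∑ r ∈ Finset.range R, (-(‖t‖ ^ 2 * v / 4 : ℝ) : ℂ) ^ r / (r.factorial : ℂ) := by
  induction R with
  | zero => simp
  | succ R ih =>
    rw [show 2 * (R + 1) = 2 * R + 1 + 1 by ring, Finset.sum_range_succ, Finset.sum_range_succ,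
      Finset.sum_range_succ, ih, gaussianProjMoment_odd, mul_zero, add_zero,
      gaussianProjMoment_even]
    congr 1
    have h1 : ((2 * R).factorial : ℂ) ≠ 0 := by exact_mod_cast (2 * R).factorial_ne_zero
    rw [pow_mul, Complex.I_sq, neg_pow ((‖t‖ ^ 2 * v / 4 : ℝ) : ℂ)]
    field_simp

lemma re_conj_mul_pow_eq (x t : ℂ) (k : ℕ) :
    (((t * conj x).re ^ k : ℝ) : ℂ) = (2 ^ k)⁻¹ * ∑ i ∈ Finset.range (k + 1),
      (k.choose i : ℂ) * conj t ^ i * t ^ (k - i) * (x ^ i * conj x ^ (k - i)) := by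
  have h : (((t * conj x).re : ℝ) : ℂ) = 2⁻¹ * (conj t * x + t * conj x) := by
    rw [Complex.re_eq_add_conj]
    simp only [map_mul, Complex.conj_conj]
    ring
  rw [Complex.ofReal_pow, h, mul_pow, inv_pow, add_pow]
  congr 1
  refine Finset.sum_congr rfl fun i _ => ?_
  rw [mul_pow, mul_pow]
  ring

lemma integral_re_conj_mul_pow {Ω : Type*} [MeasurableSpace Ω] {P : Measure Ω}
    {X : Ω → ℂ} (t : ℂ) (k : ℕ)
    (hI : ∀ i ≤ k, Integrable (fun ω => X ω ^ i * conj (X ω) ^ (k - i)) P) :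
    Integrable (fun ω => (((t * conj (X ω)).re ^ k : ℝ) : ℂ)) P ∧
    ∫ ω, (((t * conj (X ω)).re ^ k : ℝ) : ℂ) ∂P = (2 ^ k)⁻¹ * ∑ i ∈ Finset.range (k + 1),
      (k.choose i : ℂ) * conj t ^ i * t ^ (k - i) * ∫ ω, X ω ^ i * conj (X ω) ^ (k - i) ∂P := by
  have hI' : ∀ i ∈ Finset.range (k + 1), Integrable (fun ω => (k.choose i : ℂ) * conj t ^ i *
      t ^ (k - i) * (X ω ^ i * conj (X ω) ^ (k - i))) P := fun i hi =>
    (hI i (by simp at hi; omega)).const_mul _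
  simp only [re_conj_mul_pow_eq]
  refine ⟨(integrable_finsetSum _ hI').const_mul _, ?_⟩
  rw [integral_const_mul, integral_finsetSum _ hI']
  simp only [integral_const_mul]

/-- A sequence of complex random variables whose mixed moments converge to those of a complex
Gaussian has converging characteristic functions. -/
theorem tendsto_integral_exp_of_moments {X : (n : ℕ) → Ω n → ℂ}
    (hX : ∀ n, AEMeasurable (X n) (P n)) {v : ℝ}
    (hI : ∀ p q, ∀ᶠ n in atTop, Integrable (fun ω => X n ω ^ p * conj (X n ω) ^ q) (P n))
    (hlim : ∀ p q, Tendsto (fun n => ∫ ω, X n ω ^ p * conj (X n ω) ^ q ∂(P n)) atTop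
      (𝓝 (if p = q then ((p.factorial * v ^ p : ℝ) : ℂ) else 0))) (t : ℂ) :
    Tendsto (fun n => ∫ ω, Complex.exp (((t * conj (X n ω)).re : ℝ) * Complex.I) ∂(P n)) atTop
      (𝓝 (Complex.exp (-(‖t‖ ^ 2 * v / 4 : ℝ)))) := by
  set c : ℝ := ‖t‖ ^ 2 * v / 4 with hc
  let T : (n : ℕ) → Ω n → ℝ := fun n ω => (t * conj (X n ω)).re
  have hIk : ∀ k, ∀ᶠ n in atTop, ∀ i ≤ k,
      Integrable (fun ω => X n ω ^ i * conj (X n ω) ^ (k - i)) (P n) := by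
    intro k
    have : ∀ᶠ n in atTop, ∀ i ∈ Finset.range (k + 1),
        Integrable (fun ω => X n ω ^ i * conj (X n ω) ^ (k - i)) (P n) := by
      rw [Filter.eventually_all_finset]
      exact fun i _ => hI i (k - i)
    filter_upwards [this] with n hn i hi using hn i (by simp; omega)
  have hTlim : ∀ k, Tendsto (fun n => ∫ ω, ((T n ω ^ k : ℝ) : ℂ) ∂(P n)) atTop
      (𝓝 (gaussianProjMoment v t k)) := by
    intro k
    have h1 : Tendsto (fun n => (2 ^ k : ℂ)⁻¹ * ∑ i ∈ Finset.range (k + 1),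
        (k.choose i : ℂ) * conj t ^ i * t ^ (k - i) *
          ∫ ω, X n ω ^ i * conj (X n ω) ^ (k - i) ∂(P n)) atTop (𝓝 (gaussianProjMoment v t k)) :=
      (tendsto_finsetSum _ fun i _ => (hlim i (k - i)).const_mul _).const_mul _
    refine h1.congr' ?_
    filter_upwards [hIk k] with n hn
    exact (integral_re_conj_mul_pow t k hn).2.symm
  have hTmeas : ∀ n, AEMeasurable (T n) (P n) := fun n =>
    (Continuous.measurable (by fun_prop : Continuous fun x : ℂ => (t * conj x).re)).comp_aemeasurable
      (hX n)
  have hexpint : ∀ n, Integrable (fun ω => Complex.exp ((T n ω : ℝ) * Complex.I)) (P n) := by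
    intro n
    refine Integrable.of_bound (C := 1) ?_ (Eventually.of_forall fun ω => ?_)
    · exact ((Continuous.measurable (by fun_prop :
        Continuous fun x : ℝ => Complex.exp (x * Complex.I))).comp_aemeasurable
          (hTmeas n)).aestronglyMeasurable
    · rw [Complex.norm_exp_ofReal_mul_I]
  -- Truncation at the even order `2 * R` makes `|T| ^ (2 * R)` equal to `T ^ (2 * R)`, so the
  -- remainder is itself a moment with a known limit.
  have hbound : ∀ R, ∀ᶠ n in atTop, ‖(∫ ω, Complex.exp ((T n ω : ℝ) * Complex.I) ∂(P n)) -
      ∑ k ∈ Finset.range (2 * R), Complex.I ^ k / (k.factorial : ℂ) *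
        ∫ ω, ((T n ω ^ k : ℝ) : ℂ) ∂(P n)‖ ≤
      ‖∫ ω, ((T n ω ^ (2 * R) : ℝ) : ℂ) ∂(P n)‖ / ((2 * R).factorial : ℝ) := by
    intro R
    have hall : ∀ᶠ n in atTop, ∀ k ∈ Finset.range (2 * R + 1), ∀ i ≤ k,
        Integrable (fun ω => X n ω ^ i * conj (X n ω) ^ (k - i)) (P n) := by
      rw [Filter.eventually_all_finset]
      exact fun k _ => hIk k
    filter_upwards [hall] with n hn
    have hint : ∀ k ∈ Finset.range (2 * R + 1),
        Integrable (fun ω => ((T n ω ^ k : ℝ) : ℂ)) (P n) := fun k hk =>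
      (integral_re_conj_mul_pow t k (hn k hk)).1
    have hint' : ∀ k ∈ Finset.range (2 * R), Integrable (fun ω =>
        Complex.I ^ k / (k.factorial : ℂ) * ((T n ω ^ k : ℝ) : ℂ)) (P n) := fun k hk =>
      (hint k (by simp at hk ⊢; omega)).const_mul _
    simp only [← integral_const_mul]
    rw [← integral_finsetSum _ hint', ← integral_sub (hexpint n) (integrable_finsetSum _ hint')]
    have h2R : Integrable (fun ω => T n ω ^ (2 * R)) (P n) := by
      have h := (hint (2 * R) (by simp)).re
      simpa only [RCLike.re_to_complex, Complex.ofReal_re] using h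
    have hnonneg : 0 ≤ ∫ ω, T n ω ^ (2 * R) ∂(P n) :=
      integral_nonneg fun ω => by simp only [pow_mul]; positivity
    rw [integral_complex_ofReal, Complex.norm_real, Real.norm_of_nonneg hnonneg,
      ← integral_div]
    refine norm_integral_le_of_norm_le (h2R.div_const _) (Eventually.of_forall fun ω => ?_)
    have h := norm_exp_mul_I_sub_sum_le (2 * R) (T n ω)
    rw [(even_two_mul R).pow_abs] at h
    refine le_trans (le_of_eq ?_) h
    congr 2
    refine Finset.sum_congr rfl fun k _ => ?_
    rw [mul_pow]
    push_cast
    ring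
  have hA : Tendsto (fun R : ℕ => ∑ r ∈ Finset.range R, (-(c : ℝ) : ℂ) ^ r / (r.factorial : ℂ))
      atTop (𝓝 (Complex.exp (-(c : ℝ)))) := by
    rw [Complex.exp_eq_exp_ℂ]
    exact (NormedSpace.expSeries_div_hasSum_exp (-(c : ℝ) : ℂ)).tendsto_sum_nat
  have hB : Tendsto (fun R : ℕ => |c| ^ R / (R.factorial : ℝ)) atTop (𝓝 0) :=
    FloorSemiring.tendsto_pow_div_factorial_atTop |c|
  -- The limiting remainder is a term of the series of `exp |c|`. Thus `R` can be fixed first, to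
  -- make both this and the exponential tail small, and `n` sent to infinity afterwards.
  have hL2R : ∀ R, ‖gaussianProjMoment v t (2 * R)‖ / ((2 * R).factorial : ℝ) =
      |c| ^ R / (R.factorial : ℝ) := by
    intro R
    rw [gaussianProjMoment_even, ← hc, norm_mul, norm_div, norm_pow, Complex.norm_real,
      Complex.norm_natCast, Complex.norm_natCast, Real.norm_eq_abs]
    have : ((2 * R).factorial : ℝ) ≠ 0 := by exact_mod_cast (2 * R).factorial_ne_zero
    field_simp
  rw [Metric.tendsto_nhds]
  intro ε hε
  obtain ⟨R, hR1, hR2⟩ := ((Metric.tendsto_nhds.mp hA (ε / 4) (by positivity)).and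
    (hB.eventually_lt_const (show 0 < ε / 4 by positivity))).exists
  have hAn : Tendsto (fun n => ∑ k ∈ Finset.range (2 * R), Complex.I ^ k / (k.factorial : ℂ) *
      ∫ ω, ((T n ω ^ k : ℝ) : ℂ) ∂(P n)) atTop
      (𝓝 (∑ r ∈ Finset.range R, (-(c : ℝ) : ℂ) ^ r / (r.factorial : ℂ))) := by
    rw [hc, ← sum_gaussianProjMoment]
    exact tendsto_finsetSum _ fun k _ => (hTlim k).const_mul _
  have hBn : Tendsto (fun n => ‖∫ ω, ((T n ω ^ (2 * R) : ℝ) : ℂ) ∂(P n)‖ /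
      ((2 * R).factorial : ℝ)) atTop (𝓝 (|c| ^ R / (R.factorial : ℝ))) := by
    rw [← hL2R]
    exact (hTlim (2 * R)).norm.div_const _
  filter_upwards [hbound R, Metric.tendsto_nhds.mp hAn (ε / 4) (by positivity),
    hBn.eventually_lt_const hR2] with n h1 h2 h3
  have h4 := dist_triangle4 (∫ ω, Complex.exp ((T n ω : ℝ) * Complex.I) ∂(P n))
    (∑ k ∈ Finset.range (2 * R), Complex.I ^ k / (k.factorial : ℂ) *
      ∫ ω, ((T n ω ^ k : ℝ) : ℂ) ∂(P n))
    (∑ r ∈ Finset.range R, (-(c : ℝ) : ℂ) ^ r / (r.factorial : ℂ)) (Complex.exp (-(c : ℝ)))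
  rw [← dist_eq_norm] at h1
  exact h4.trans_lt (by linarith)

end MethodOfMoments

/-! ### Characteristic function of the complex Gaussian -/

section Gaussian

lemma charFun_complexGaussian_zero (v : ℝ≥0) (t : ℂ) :
    charFun (complexGaussian 0 v) t = Complex.exp (-(‖t‖ ^ 2 * v / 4 : ℝ)) := by
  rw [charFun_apply, complexGaussian, integral_map_equiv]
  have h : ∀ p : ℝ × ℝ, Complex.exp
      ((inner ℝ (Complex.measurableEquivRealProd.symm p) t : ℝ) * Complex.I) =
      Complex.exp (t.re * p.1 * Complex.I) * Complex.exp (t.im * p.2 * Complex.I) := by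
    intro p
    rw [← Complex.exp_add, Complex.inner]
    congr 1
    simp [Complex.measurableEquivRealProd_symm_apply]
    ring
  simp only [h]
  rw [integral_prod_mul (fun x : ℝ => Complex.exp (t.re * x * Complex.I))
    (fun x : ℝ => Complex.exp (t.im * x * Complex.I)), ← charFun_apply_real, ← charFun_apply_real,
    charFun_gaussianReal, charFun_gaussianReal, ← Complex.exp_add]
  congr 1
  have h2 : ((‖t‖ : ℂ)) ^ 2 = (t.re : ℂ) ^ 2 + (t.im : ℂ) ^ 2 := by
    have : ‖t‖ ^ 2 = t.re ^ 2 + t.im ^ 2 := by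
      rw [Complex.sq_norm, Complex.normSq_apply]
      ring
    exact_mod_cast this
  push_cast
  rw [h2]
  simp
  ring

end Gaussian

/-! ### Consequences of the moment ratio hypothesis -/

section Regularity

lemma absMoment_eq_evenMoment (μ : Measure ℂ) {k : ℤ} {j : ℕ} (h : k = 2 * (j : ℤ)) :
    absMoment μ k = evenMoment μ j := by
  have : k = ((2 * j : ℕ) : ℤ) := by push_cast; exact h
  rw [this, absMoment, evenMoment]
  simp only [zpow_natCast]

lemma evenMoment_nonneg (μ : Measure ℂ) (j : ℕ) : 0 ≤ evenMoment μ j :=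
  integral_nonneg fun z => by positivity

lemma integrable_of_evenMoment_pos {μ : Measure ℂ} {j : ℕ} (h : 0 < evenMoment μ j) :
    Integrable (fun u : ℂ => ‖u‖ ^ (2 * j)) μ := by
  by_contra hn
  rw [evenMoment, integral_undef hn] at h
  exact lt_irrefl _ h

/-- A vanishing moment would force all mass to the origin, and then the moment of order `2 * n`
would vanish as well. -/
lemma evenMoment_pos_of_le {μ : Measure ℂ} [IsProbabilityMeasure μ] {j n N : ℕ} (hn : 1 ≤ n)
    (hpos : 0 < evenMoment μ n) (hj : j ≤ N) (hN : 0 < evenMoment μ N) : 0 < evenMoment μ j := by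
  refine (evenMoment_nonneg μ j).lt_of_ne' fun h0 => ?_
  have hint := integrable_pow_of_le hj (integrable_of_evenMoment_pos hN)
  rw [evenMoment, integral_eq_zero_iff_of_nonneg (fun z => by positivity) hint] at h0
  refine hpos.ne' (integral_eq_zero_of_ae ?_)
  filter_upwards [h0] with u hu
  have hu0 : ‖u‖ = 0 := by
    by_contra h
    exact pow_ne_zero _ h hu
  simp [hu0]
  omega

/-- A divergent integral has the default value 0, as has division by 0. A ratio near one therefore
already forces the moments to be positive, hence finite. Finitely many shifts `m` in `[-d, d]` are
handled at once. -/
lemma regularMoments_of_ratio {μ : ℕ → Measure ℂ} (hμ : ∀ n, 1 ≤ n → IsProbabilityMeasure (μ n))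
    (hM : ∀ m : ℤ, Tendsto
      (fun n : ℕ => absMoment (μ n) (2 * (n : ℤ) + 2 * m) / absMoment (μ n) (2 * (n : ℤ)))
      atTop (𝓝 1)) : RegularMoments μ := by
  intro d b hb
  have hb0 : 0 < b := by linarith
  have hall : ∀ᶠ n : ℕ in atTop, ∀ m ∈ Finset.Icc (-(d : ℤ)) d,
      absMoment (μ n) (2 * (n : ℤ) + 2 * m) / absMoment (μ n) (2 * (n : ℤ)) ∈
        Set.Ioo b⁻¹ b := by
    rw [Filter.eventually_all_finset]
    exact fun m _ => (hM m).eventually (Ioo_mem_nhds (inv_lt_one_of_one_lt₀ hb) hb)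
  filter_upwards [hall, eventually_ge_atTop 1] with n hn hn1
  have := hμ n hn1
  have hratio : ∀ j : ℕ, n ≤ j + d → j ≤ n + d →
      evenMoment (μ n) j / evenMoment (μ n) n ∈ Set.Ioo b⁻¹ b := by
    intro j h1 h2
    have h := hn ((j : ℤ) - n) (by simp; omega)
    rwa [absMoment_eq_evenMoment (μ n) (j := j) (by ring),
      absMoment_eq_evenMoment (μ n) (j := n) rfl] at h
  have hne : ∀ j : ℕ, n ≤ j + d → j ≤ n + d → 0 < evenMoment (μ n) j / evenMoment (μ n) n :=
    fun j h1 h2 => (inv_pos.mpr hb0).trans (hratio j h1 h2).1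
  have hn0 : 0 < evenMoment (μ n) n := by
    refine (evenMoment_nonneg _ _).lt_of_ne' fun h0 => ?_
    have h := hne n (by omega) (by omega)
    rw [h0, div_zero] at h
    exact lt_irrefl _ h
  have hposr : ∀ j : ℕ, n ≤ j + d → j ≤ n + d → 0 < evenMoment (μ n) j := fun j h1 h2 =>
    (div_pos_iff_of_pos_right hn0).mp (hne j h1 h2)
  have hN := hposr (n + d) (by omega) le_rfl
  refine ⟨integrable_of_evenMoment_pos hN, fun j hj => evenMoment_pos_of_le hn1 hn0 hj hN,
    fun j h1 h2 => ?_⟩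
  have h := hratio j h1 h2.le
  constructor
  · exact ((div_lt_iff₀ hn0).mp h.2).le
  · have h3 := (lt_div_iff₀ hn0).mp h.1
    rw [inv_mul_lt_iff₀ hb0] at h3
    exact h3.le

end Regularity

/-! ### The energy as a Dirichlet integral -/

section Energy

open AlternatingPolynomial

lemma isRotationInvariant_volume_ball :
    IsRotationInvariant (volume.restrict (Metric.ball (0 : ℂ) 1)) := by
  intro c hc
  let L : ℂ ≃ₗᵢ[ℝ] ℂ := rotation ⟨c, by simpa [Submonoid.unitSphere] using hc⟩
  have hL : (fun z : ℂ => c * z) = L := by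
    ext z
    rfl
  have hmp : MeasurePreserving L volume volume := L.measurePreserving
  have hpre : L ⁻¹' Metric.ball (0 : ℂ) 1 = Metric.ball 0 1 := by
    ext z
    simp
  have h := hmp.restrict_preimage (s := Metric.ball (0 : ℂ) 1) measurableSet_ball
  rw [hpre] at h
  rw [hL]
  exact h.map_eq

lemma evenMoment_volume_ball (j : ℕ) :
    evenMoment (volume.restrict (Metric.ball (0 : ℂ) 1)) j = Real.pi / (j + 1) := by
  have h1 : evenMoment (volume.restrict (Metric.ball (0 : ℂ) 1)) j =
      ∫ z : ℂ, (Set.Iio (1 : ℝ)).indicator (fun r => r ^ (2 * j)) ‖z‖ := by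
    rw [evenMoment, ← integral_indicator measurableSet_ball]
    refine integral_congr_ae (Eventually.of_forall fun z => ?_)
    simp only [Set.indicator, Metric.mem_ball, dist_zero_right, Set.mem_Iio]
  have h2 : ∀ r : ℝ, r ^ (Module.finrank ℝ ℂ - 1) •
      (Set.Iio (1 : ℝ)).indicator (fun r => r ^ (2 * j)) r =
      (Set.Iio (1 : ℝ)).indicator (fun r => r ^ (2 * j + 1)) r := by
    intro r
    rw [Complex.finrank_real_complex]
    by_cases hr : r < 1
    · simp [Set.indicator, hr, pow_succ']
    · simp [Set.indicator, hr]
  rw [h1, integral_fun_norm_addHaar]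
  simp only [h2]
  rw [setIntegral_indicator measurableSet_Iio, Set.Ioi_inter_Iio, ← integral_Ioc_eq_integral_Ioo,
    ← intervalIntegral.integral_of_le zero_le_one, integral_pow, Complex.finrank_real_complex,
    Measure.real, Complex.volume_ball]
  simp
  field_simp
  ring

/-- Monomials are orthogonal on the disk with squared norms `π / (l + 1)`, and the derivative
contributes `(l + 1) ^ 2 * |a (l + 1)| ^ 2`. -/
lemma integral_ball_norm_sq_derivative (f : ℂ[X]) :
    (1 / Real.pi) * ∫ w in Metric.ball (0 : ℂ) 1, ‖f.derivative.eval w‖ ^ 2 = energy f := by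
  set lam : Measure ℂ := volume.restrict (Metric.ball (0 : ℂ) 1) with hlam
  have hfin : IsFiniteMeasure lam := ⟨by simp [hlam, Complex.volume_ball]⟩
  have hL : ∀ p : ℂ[X], MemLp (fun z => p.eval z) 2 lam := by
    intro p
    refine MemLp.of_bound p.continuous.aestronglyMeasurable
      ((∑ k ∈ Finset.range (p.natDegree + 1), ‖p.coeff k‖) * (1 + 1)) ?_
    refine (ae_restrict_mem measurableSet_ball).mono fun z hz => (norm_eval_le p z).trans ?_
    have hz1 : ‖z‖ ≤ 1 := by simpa using (Metric.mem_ball.mp hz).le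
    gcongr
    exact pow_le_one₀ (norm_nonneg _) hz1
  set D := f.natDegree with hD
  have hdeg : f.derivative ∈ degreeLT ℂ D := by
    rcases Nat.eq_zero_or_pos D with h0 | h0
    · rw [derivative_of_natDegree_zero (hD ▸ h0)]
      exact Submodule.zero_mem _
    · rw [mem_degreeLT]
      have hne : f ≠ 0 := by
        rintro rfl
        simp at hD
        omega
      exact (degree_derivative_lt hne).trans_eq (degree_eq_natDegree hne)
  have hC : ((∫ w, ‖f.derivative.eval w‖ ^ 2 ∂lam : ℝ) : ℂ) =
      ((Real.pi * energy f : ℝ) : ℂ) := by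
    rw [← integral_complex_ofReal]
    have h1 : ∀ w, ((‖f.derivative.eval w‖ ^ 2 : ℝ) : ℂ) = ∑ l ∈ Finset.range D,
        conj (f.derivative.coeff l) * (f.derivative.eval w * conj (w ^ l)) := by
      intro w
      push_cast
      rw [← Complex.mul_conj']
      conv_lhs => enter [2]; rw [eval_eq_sum_of_mem_degreeLT hdeg]
      rw [map_sum, Finset.mul_sum]
      refine Finset.sum_congr rfl fun l _ => ?_
      rw [map_mul]
      ring
    simp only [h1]
    rw [integral_finsetSum]
    · simp only [integral_const_mul]
      rw [energy, ← hD, Finset.sum_range_succ', mul_add, Finset.mul_sum]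
      push_cast
      simp only [zero_mul, mul_zero, add_zero]
      refine Finset.sum_congr rfl fun l hl => ?_
      rw [integral_eval_mul_conj_pow isRotationInvariant_volume_ball (fun p _ => hL p) hdeg
        (by simpa using hl), evenMoment_volume_ball, coeff_derivative]
      have hl0 : ((l : ℂ) + 1) ≠ 0 := by exact_mod_cast l.succ_ne_zero
      push_cast
      rw [← Complex.mul_conj']
      simp only [map_mul, map_add, map_natCast, map_one]
      field_simp
    · intro l _
      have h2 : MemLp (fun z : ℂ => z ^ l) 2 lam := by simpa using hL (X ^ l)
      exact ((hL _).integrable_mul h2.star).const_mul _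
  rw [Complex.ofReal_inj.mp hC]
  field_simp

lemma energy_sub_C (f : ℂ[X]) : energy (f - C (f.coeff 0)) = energy f := by
  rw [← integral_ball_norm_sq_derivative, ← integral_ball_norm_sq_derivative]
  simp

lemma energy_nonneg (f : ℂ[X]) : 0 ≤ energy f :=
  Finset.sum_nonneg fun k _ => by positivity

end Energy

end

/-! ### The central limit theorem -/

theorem theorem3
    {Ω : ℕ → Type*} [∀ n, MeasurableSpace (Ω n)]
    (P : (n : ℕ) → Measure (Ω n)) [∀ n, IsProbabilityMeasure (P n)]
    (μ : ℕ → Measure ℂ)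
    (z : (n : ℕ) → Ω n → Fin n → ℂ)
    (hz : ∀ n, 1 ≤ n → IsSPPProcess (P n) (μ n) n (z n))
    (hM : ∀ m : ℤ, Tendsto
      (fun n : ℕ => absMoment (μ n) (2 * (n : ℤ) + 2 * m) / absMoment (μ n) (2 * (n : ℤ)))
      atTop (𝓝 1))
    (f : Polynomial ℂ) :
    (∀ᶠ n in atTop, ∀ k : Fin n, Integrable (fun ω => f.eval (z n ω k)) (P n)) ∧
    TendstoInDistribution
      (fun n ω => ∑ k : Fin n, (f.eval (z n ω k) - ∫ ω', f.eval (z n ω' k) ∂(P n)))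
      atTop
      (id : ℂ → ℂ)
      P
      (complexGaussian 0
        (Real.toNNReal
          ((1 / Real.pi) * ∫ w in Metric.ball (0 : ℂ) 1, ‖f.derivative.eval w‖ ^ 2))) := by
  have hreg : RegularMoments μ :=
    regularMoments_of_ratio (fun n hn => (hz n hn).isProbabilityMeasure) hM
  -- Centering removes the constant term anyway, and without it the lowering operator annihilates
  -- the vacuum.
  set g : ℂ[X] := f - C (f.coeff 0) with hg
  have hg0 : g.coeff 0 = 0 := by simp [hg]
  have hint : ∀ q : ℂ[X], ∀ᶠ n in atTop, ∀ k : Fin n,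
      Integrable (fun ω => q.eval (z n ω k)) (P n) := by
    intro q
    filter_upwards [hreg q.natDegree 2 one_lt_two, eventually_ge_atTop 1] with n hn hn1 k
    exact (hz n hn1).integrable_eval (fun j hj => hn.2.1 j (by omega)) q hn.1 k
  have hzmeas : ∀ n, ∀ k : Fin n, AEMeasurable (fun ω => z n ω k) (P n) := fun n k =>
    (measurable_pi_apply k).comp_aemeasurable (hz n (by have := k.2; omega)).aemeasurable
  have hpmeas : ∀ (q : ℂ[X]) n, ∀ k : Fin n, AEMeasurable (fun ω => q.eval (z n ω k)) (P n) :=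
    fun q n k => q.continuous.measurable.comp_aemeasurable (hzmeas n k)
  let S : (n : ℕ) → Ω n → ℂ := fun n ω => ∑ k, g.eval (z n ω k)
  have hSmeas : ∀ n, AEMeasurable (S n) (P n) := fun n =>
    Finset.aemeasurable_fun_sum _ fun k _ => hpmeas g n k
  have hYmeas : ∀ n, AEMeasurable (fun ω => ∑ k : Fin n,
      (f.eval (z n ω k) - ∫ ω', f.eval (z n ω' k) ∂(P n))) (P n) := fun n =>
    Finset.aemeasurable_fun_sum _ fun k _ => (hpmeas f n k).sub_const _
  have hmom := tendsto_integral_linStat_pow hz hreg hg0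
  have hmomint : ∀ p q, ∀ᶠ n in atTop,
      Integrable (fun ω => S n ω ^ p * conj (S n ω) ^ q) (P n) := by
    intro p q
    filter_upwards [hreg (max p q * g.natDegree) 2 one_lt_two, eventually_ge_atTop 1] with n hn hn1
    have hpd : p * g.natDegree ≤ max p q * g.natDegree := Nat.mul_le_mul_right _ (le_max_left p q)
    have hqd : q * g.natDegree ≤ max p q * g.natDegree := Nat.mul_le_mul_right _ (le_max_right p q)
    exact ((hz n hn1).integral_linStat_pow (fun j hj => hn.2.1 j (by omega)) g hn.1
      (by omega) (by omega)).1
  have hmean : Tendsto (fun n => ∫ ω, S n ω ∂(P n)) atTop (𝓝 0) := by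
    simpa using hmom 1 0
  have hY : ∀ᶠ n in atTop, ∀ ω, ∑ k : Fin n,
      (f.eval (z n ω k) - ∫ ω', f.eval (z n ω' k) ∂(P n)) = S n ω - ∫ ω', S n ω' ∂(P n) := by
    filter_upwards [hint f, hint g] with n hf hgi ω
    rw [integral_finsetSum _ fun k _ => hgi k, ← Finset.sum_sub_distrib]
    refine Finset.sum_congr rfl fun k _ => ?_
    have : ∫ ω', g.eval (z n ω' k) ∂(P n) = ∫ ω', f.eval (z n ω' k) ∂(P n) - f.coeff 0 := by
      simp only [hg, eval_sub, eval_C]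
      rw [integral_sub (hf k) (integrable_const _)]
      simp
    rw [this]
    simp [hg]
  refine ⟨hint f, ⟨hYmeas, aemeasurable_id, ?_⟩⟩
  refine ProbabilityMeasure.tendsto_of_tendsto_charFun fun t => ?_
  simp only [ProbabilityMeasure.coe_mk, Measure.map_id]
  rw [integral_ball_norm_sq_derivative, charFun_complexGaussian_zero,
    Real.coe_toNNReal _ (energy_nonneg f), ← energy_sub_C, ← hg]
  have hlim := tendsto_integral_exp_of_moments hSmeas hmomint hmom t
  -- The centered sum is `S` minus its mean, which tends to 0, so centering multiplies the
  -- characteristic function by a phase tending to 1.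
  have hphase : Tendsto (fun n => Complex.exp
      (-((t * conj (∫ ω, S n ω ∂(P n))).re : ℝ) * Complex.I)) atTop (𝓝 1) := by
    have hcont : Continuous fun u : ℂ => Complex.exp (-((t * conj u).re : ℝ) * Complex.I) := by
      fun_prop
    have h := (hcont.tendsto 0).comp hmean
    simp only [map_zero, mul_zero, Complex.zero_re, Complex.ofReal_zero, neg_zero, zero_mul,
      Complex.exp_zero] at h
    exact h
  have hprod := hlim.mul hphase
  rw [mul_one] at hprod
  refine hprod.congr' ?_
  filter_upwards [hY] with n hn
  rw [charFun_apply, integral_map (hYmeas n) (Continuous.aestronglyMeasurable (by fun_prop)),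
    ← integral_mul_const]
  refine integral_congr_ae (Eventually.of_forall fun ω => ?_)
  simp only
  rw [hn ω, ← Complex.exp_add, Complex.inner]
  congr 1
  rw [map_sub, mul_sub, Complex.sub_re]
  push_cast
  ring
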